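/- Let $n\ge 2$, let $\mathbb{F}$ be one of $\mathbb{R},\mathbb{C},\mathbb{H}$, let $m=\dim_{\mathbb{R}}\mathbb{F}\in\{1,2,4\}$, and put $p=\left\lfloor\frac{n-1}{2}\right\rfloor$. Let $E(n,\mathbb{F})=\{A\in M(n,\mathbb{F}): A^*=A,\ \operatorname{tr}A=0\}$ be the real vector space of traceless Hermitian $n\times n$ matrices over $\mathbb{F}$, of dimension $N(n,\mathbb{F})=\frac12 n(n-1)m+n-1$, and let $S(n,\mathbb{F})$ be its unit sphere with respect to the Frobenius norm. Define $$\Phi_{n,\mathbb{F}}:S(n,\mathbb{F})\to\mathbb{R}^p,\qquad A\mapsto(\operatorname{tr}A^3,\operatorname{tr}A^5,\dots,\operatorname{tr}A^{2p+1}),$$ and let $\mathcal{B}_{n,\mathbb{F}}$ be the set of all $A\in\Phi_{n,\mathbb{F}}^{-1}(0)$ that are regular points of $\Phi_{n,\mathbb{F}}$, i.e. at which the differential of $\Phi_{n,\mathbb{F}}$ is surjective. Then $\mathcal{B}_{n,\mathbb{F}}$ is a smooth embedded submanifold of $S(n,\mathbb{F})$ of dimension $N(n,\mathbb{F})-p-1$,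 and it is 1. orientable; 2. connected (and nonempty); 3. full, i.e. not contained in any proper great subsphere of $S(n,\mathbb{F})$; 4. austere in $S(n,\mathbb{F})$, i.e. for every normal vector $\xi$, the nonzero principal curvatures in direction $\xi$ occur in oppositely signed pairs: $c$ and $-c$ have the same multiplicity as eigenvalues of the shape operator $A_\xi$, for every real $c$; 5. of flat normal bundle in $S(n,\mathbb{F})$, i.e. its normal connection is flat: every normal vector extends locally to a parallel normal field. -/

import Mathlib

open scoped Matrix.Norms.Frobenius Quaternion ContDiff

noncomputable section

/-! ### Submanifolds of a submanifold of a Euclidean space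

Throughout, `V` is a finite-dimensional real inner product space, and submanifolds are embedded
submanifolds of `V`, with the induced metric. -/

namespace EuclideanSubmanifold

variable {V : Type*} [NormedAddCommGroup V] [InnerProductSpace ℝ V] [FiniteDimensional ℝ V]

/-- `M` is a smooth embedded submanifold of `V` of dimension `d`: around each of its points some
smooth diffeomorphism between open subsets of `V` carries `M` to a `d`-dimensional linear
subspace. -/
def IsSubmanifold (M : Set V) (d : ℕ) : Prop :=
  ∀ x ∈ M, ∃ (W : Submodule ℝ V) (φ : OpenPartialHomeomorph V V),
    Module.finrank ℝ W = d ∧ x ∈ φ.source ∧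
    ContDiffOn ℝ ∞ φ φ.source ∧ ContDiffOn ℝ ∞ φ.symm φ.target ∧
    ∀ y ∈ φ.source, y ∈ M ↔ φ y ∈ W

/-- The tangent space of `M` at `x`, spanned by the velocities at `x` of smooth curves in `M`. (For
a submanifold these velocities already form a linear subspace.) -/
def tangentSpace (M : Set V) (x : V) : Submodule ℝ V :=
  Submodule.span ℝ {v | ∃ γ : ℝ → V, ContDiffAt ℝ ∞ γ 0 ∧ γ 0 = x ∧
    (∀ᶠ t in nhds (0 : ℝ), γ t ∈ M) ∧ deriv γ 0 = v}

/-- The normal space at `x` of `M`, regarded as a submanifold of the submanifold `N`: the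
orthogonal complement of `T_x M` in `T_x N`. -/
def normalSpace (N M : Set V) (x : V) : Submodule ℝ V :=
  tangentSpace N x ⊓ (tangentSpace M x)ᗮ

/-- The differential at `x` of the map `Φ` restricted to the submanifold `M`. (On `T_x M` the
derivative within `M` does not depend on choices.) -/
def differential {G : Type*} [NormedAddCommGroup G] [NormedSpace ℝ G]
    (M : Set V) (Φ : V → G) (x : V) : tangentSpace M x →L[ℝ] G :=
  (fderivWithin ℝ Φ M x).comp (tangentSpace M x).subtypeL

/-- `x` is a regular point of the restriction of `Φ` to the submanifold `M`. -/
def IsRegularPoint {G : Type*} [NormedAddCommGroup G] [NormedSpace ℝ G]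
    (M : Set V) (Φ : V → G) (x : V) : Prop :=
  Function.Surjective (differential M Φ x)

/-- `M` is orientable: it carries a smooth differential form of top degree `d` without zeros. (Every
smooth form on `M` arises from a smooth map on `M` to the alternating forms on `V`.) -/
def IsOrientable (M : Set V) (d : ℕ) : Prop :=
  ∃ η : V → V [⋀^Fin d]→L[ℝ] ℝ, ContDiffOn ℝ ∞ η M ∧
    ∀ x ∈ M, ∃ v : Fin d → V, (∀ i, v i ∈ tangentSpace M x) ∧ η x v ≠ 0

/-- `ξ` is a smooth normal vector field along `M ∩ U`, for `M` as a submanifold of `N`. -/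
structure IsNormalField (N M U : Set V) (ξ : V → V) : Prop where
  smooth : ContDiffOn ℝ ∞ ξ (M ∩ U)
  normal : ∀ y ∈ M ∩ U, ξ y ∈ normalSpace N M y

/-- The shape operator `X ↦ -(∇_X ξ)ᵀ` of `M` at `x` in direction of the normal field `ξ`. Here `∇`
is the Levi-Civita connection of the ambient submanifold `N ⊇ M`, that is the projection to `T N` of
the directional derivative in `V`; as `T M ⊆ T N`, its component tangent to `M` is the
projection to `T M` of the directional derivative. -/
def shapeOperator (M : Set V) (ξ : V → V) (x : V) :
    tangentSpace M x →L[ℝ] tangentSpace M x :=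
  -((tangentSpace M x).orthogonalProjectionOnto.comp (differential M ξ x))

/-- `M ⊆ N` is austere: in every normal direction, opposite numbers are principal curvatures of the
same multiplicity. The principal curvatures in direction of the normal vector `ξ x` are the
eigenvalues of the (self-adjoint) shape operator. -/
def IsAustere (N M : Set V) : Prop :=
  ∀ (U : Set V) (ξ : V → V), IsOpen U → IsNormalField N M U ξ → ∀ x ∈ M ∩ U, ∀ c : ℝ,
    Module.finrank ℝ (Module.End.eigenspace
        (shapeOperator M ξ x : Module.End ℝ (tangentSpace M x)) c) =
      Module.finrank ℝ (Module.End.eigenspace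
        (shapeOperator M ξ x : Module.End ℝ (tangentSpace M x)) (-c))

/-- The covariant derivative at `x` of the normal field `ξ` for the normal connection of `M ⊆ N`, as
a map `X ↦ ∇^⊥_X ξ` from tangent to normal vectors. -/
def normalDerivative (N M : Set V) (ξ : V → V) (x : V) :
    tangentSpace M x →L[ℝ] normalSpace N M x :=
  (normalSpace N M x).orthogonalProjectionOnto.comp (differential M ξ x)

/-- The normal bundle of `M ⊆ N` is flat: every normal vector extends locally to a parallel normal
field, equivalently, there are local parallel frames. -/
def HasFlatNormalBundle (N M : Set V) : Prop :=
  ∀ x ∈ M, ∀ v ∈ normalSpace N M x, ∃ (U : Set V) (ξ : V → V), IsOpen U ∧ x ∈ U ∧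
    IsNormalField N M U ξ ∧ ξ x = v ∧ ∀ y ∈ M ∩ U, normalDerivative N M ξ y = 0

/-- The subset `M` of the unit sphere of `V` is full: it lies in no proper great subsphere. -/
def IsFull (M : Set V) : Prop :=
  ∀ W : Submodule ℝ V, M ⊆ W → W = ⊤

end EuclideanSubmanifold

/-! ### Hermitian matrices over `ℝ`, `ℂ`, `ℍ`

The definitions are written for a real normed algebra `F` with a conjugation and a real inner
product, and are used for `ℝ`, `ℂ`, `ℍ` with `⟪a, b⟫ = Re (a * star b)`. Matrices carry the
Frobenius norm. -/

namespace HermitianSphere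

open EuclideanSubmanifold

/-- The real inner product `Re tr (A Bᴴ)` that induces the Frobenius norm. -/
instance frobeniusInnerProductSpace (n : ℕ) (F : Type*) [NormedAddCommGroup F]
    [InnerProductSpace ℝ F] : InnerProductSpace ℝ (Matrix (Fin n) (Fin n) F) where
  toNormedSpace := Matrix.frobeniusNormedSpace
  inner A B := ∑ i, ∑ j, inner ℝ (A i j) (B i j)
  norm_sq_eq_re_inner A := by
    have h : 0 ≤ ∑ i, ∑ j, ‖A i j‖ ^ (2 : ℝ) := by positivity
    rw [Matrix.frobenius_norm_def, ← Real.sqrt_eq_rpow, Real.sq_sqrt h]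
    simp
  conj_inner_symm A B := by simp [real_inner_comm]
  add_left A B C := by simp [inner_add_left, Finset.sum_add_distrib]
  smul_left A B r := by simp [real_inner_smul_left, Finset.mul_sum]

instance quaternionStarModule : StarModule ℝ ℍ[ℝ] := ⟨fun r a => by simp⟩

variable (n : ℕ) (F : Type*) [NormedRing F] [StarRing F] [InnerProductSpace ℝ F] [StarModule ℝ F]

/-- `E(n, F)`: the real vector space of traceless Hermitian matrices. -/
def E : Submodule ℝ (Matrix (Fin n) (Fin n) F) where
  carrier := {A | A.IsHermitian ∧ A.trace = 0}
  add_mem' := by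
    rintro A B ⟨hA, hA'⟩ ⟨hB, hB'⟩
    exact ⟨hA.add hB, by simp [hA', hB']⟩
  zero_mem' := ⟨Matrix.isHermitian_zero, by simp⟩
  smul_mem' := by
    rintro r A ⟨hA, hA'⟩
    exact ⟨by simp [Matrix.IsHermitian, Matrix.conjTranspose_smul, hA.eq],
      by simp [hA']⟩

/-- `N(n, F) = n(n-1)m/2 + n - 1` with `m = dim_ℝ F`. -/
def N : ℕ := n * (n - 1) / 2 * Module.finrank ℝ F + n - 1

/-- `S(n, F)`: the unit sphere in `E(n, F)` for the Frobenius norm. -/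
def S : Set (E n F) := Metric.sphere 0 1

variable {n F}

/-- `f_k(A) = tr A^k`, which is real for Hermitian `A`; as a real number it is its real part. -/
def f (k : ℕ) (A : E n F) : ℝ := inner ℝ (1 : F) (Matrix.trace ((A : Matrix (Fin n) (Fin n) F) ^ k))

/-- `Φ = (f_3, f_5, …, f_{2p+1})` with `p = ⌊(n-1)/2⌋`, as a map on `E(n, F)`. -/
def Phi (A : E n F) : Fin ((n - 1) / 2) → ℝ := fun i => f (2 * (i : ℕ) + 3) A

variable (n F)

/-- `B_{n,F}`: the regular points of `Φ : S(n, F) → ℝ^p` in its zero level set. -/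
def B [FiniteDimensional ℝ F] : Set (E n F) :=
  {A | A ∈ S n F ∧ Phi A = 0 ∧ IsRegularPoint (S n F) Phi A}

end HermitianSphere

end

/-! At a point `A` of `B n F` the odd power sums of the spectrum vanish, which by Newton's
identities makes the spectrum symmetric about `0`. The differentials of the odd power traces are
the even powers of `A`, so by a Vandermonde argument `A` is regular exactly when the squares of
its eigenvalues are as distinct as this symmetry allows. As a regular level set, `B n F` is an
orientable submanifold.

The ordered spectra of this kind form a convex cone, and every Hermitian matrix is diagonalized by
the identity component of the unitary group: hence `B n F` is connected, and it is full because a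
matrix orthogonal to all of `B n F` has a spectrum orthogonal to this cone. The normal space at `A`
is spanned by the traceless parts of the even powers of `A`. Let `w` be the unitary matrix that
reverses an ordered eigenbasis of `A`; then `X ↦ -(w * X * star w)` is an isometry that preserves
`B n F`, fixes `A`, and acts as `-1` on the normal space, so that it carries the shape operator in
direction `ξ` to its negative. Finally, the spectral projections of `A ^ 2` commute with the normal
space, and the derivative of an idempotent is off-diagonal with respect to it; hence combinations of
these projections with constant coefficients are parallel normal fields. -/

noncomputable section

namespace EuclideanSubmanifold

open Filter Topology

section LinearAlgebra

theorem surjective_pi_iff_linearIndependent {K E ι : Type*} [Field K] [AddCommGroup E] [Module K E]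
    [Finite ι] (φ : ι → Module.Dual K E) :
    Function.Surjective (LinearMap.pi φ) ↔ LinearIndependent K φ := by
  classical
  cases nonempty_fintype ι
  have hcomb : ((LinearMap.pi φ).dualMap : Module.Dual K (ι → K) → Module.Dual K E) =
      Fintype.linearCombination K φ ∘ LinearEquiv.piRing K K ι K := by
    ext ψ x
    have hψ := congrArg ψ (pi_eq_sum_univ' (LinearMap.pi φ x))
    simp only [map_sum, map_smul, smul_eq_mul, LinearMap.pi_apply] at hψ
    simpa [Fintype.linearCombination_apply, LinearMap.sum_apply, mul_comm] using hψ
  rw [← LinearMap.dualMap_injective_iff, hcomb, EquivLike.injective_comp,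
    linearIndependent_iff_injective_fintypeLinearCombination]

theorem surjective_inner_iff_linearIndependent {E ι : Type*} [NormedAddCommGroup E]
    [InnerProductSpace ℝ E] [Finite ι] (b : ι → E) :
    Function.Surjective (fun X i => inner ℝ (b i) X) ↔ LinearIndependent ℝ b := by
  rw [← LinearMap.linearIndependent_iff (innerₗ E)
    (LinearMap.ker_eq_bot_of_injective fun x y h => ext_inner_right ℝ fun v => congr($h v))]
  exact surjective_pi_iff_linearIndependent fun i => innerₗ E (b i)

theorem mem_orthogonal_span_range_iff {E ι : Type*} [NormedAddCommGroup E]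
    [InnerProductSpace ℝ E] {b : ι → E} {X : E} :
    X ∈ (Submodule.span ℝ (Set.range b))ᗮ ↔ ∀ i, inner ℝ (b i) X = 0 := by
  rw [← Submodule.span_singleton_le_iff_mem, ← Submodule.isOrtho_iff_le, Submodule.isOrtho_span]
  simp [real_inner_comm]

theorem isOpen_setOf_surjective {E W : Type*} [NormedAddCommGroup E] [NormedSpace ℝ E]
    [NormedAddCommGroup W] [NormedSpace ℝ W] [FiniteDimensional ℝ W] :
    IsOpen {L : E →L[ℝ] W | Function.Surjective L} := by
  refine isOpen_iff_mem_nhds.2 fun L hL => ?_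
  obtain ⟨R, hR⟩ := L.exists_rightInverse_of_surjective (LinearMap.range_eq_top.2 hL)
  have : CompleteSpace W := FiniteDimensional.complete ℝ W
  have hnear : ∀ᶠ L' in 𝓝 L,
      L' ∘L R ∈ Set.range ((↑) : (W ≃L[ℝ] W) → W →L[ℝ] W) := by
    have hcont : Continuous fun L' : E →L[ℝ] W => L' ∘L R := by fun_prop
    refine hcont.continuousAt.eventually_mem (ContinuousLinearEquiv.isOpen.mem_nhds ?_)
    exact ⟨ContinuousLinearEquiv.refl ℝ W, by rw [hR]; rfl⟩
  filter_upwards [hnear] with L' ⟨e, he⟩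
  exact .of_comp (g := R) fun w => ⟨e.symm w, by simpa using congr($he (e.symm w)).symm⟩

theorem finrank_eigenspace_eq_finrank_eigenspace_neg {K E : Type*} [Field K] [AddCommGroup E]
    [Module K E] [FiniteDimensional K E] {T τ : Module.End K E} (hτ : Function.Injective τ)
    (hanti : ∀ x, T (τ x) = -τ (T x)) (c : K) :
    Module.finrank K (T.eigenspace c) = Module.finrank K (T.eigenspace (-c)) := by
  have hle : ∀ c, Module.finrank K (T.eigenspace c) ≤ Module.finrank K (T.eigenspace (-c)) := by
    intro c
    have hmaps : ∀ x ∈ T.eigenspace c, τ x ∈ T.eigenspace (-c) := fun x hx => by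
      rw [Module.End.mem_eigenspace_iff] at hx ⊢
      rw [hanti, hx, map_smul, neg_smul]
    exact LinearMap.finrank_le_finrank_of_injective (f := τ.restrict hmaps)
      fun x y hxy => Subtype.ext (hτ congr(($hxy : E)))
  exact le_antisymm (hle c) ((hle (-c)).trans_eq (by rw [neg_neg]))

end LinearAlgebra

theorem exists_smooth_local_inverse {W W' : Type*} [NormedAddCommGroup W] [NormedSpace ℝ W]
    [CompleteSpace W] [NormedAddCommGroup W'] [NormedSpace ℝ W'] {Φ : W → W'}
    (hΦ : ContDiff ℝ ∞ Φ) {x : W} (L : W ≃L[ℝ] W') (hL : HasFDerivAt Φ (L : W →L[ℝ] W') x)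
    {O : Set W} (hO : IsOpen O) (hx : x ∈ O) :
    ∃ e : OpenPartialHomeomorph W W', (e : W → W') = Φ ∧ x ∈ e.source ∧ e.source ⊆ O ∧
      ContDiffOn ℝ ∞ e.symm e.target ∧
      ∀ y ∈ e.source, ∃ L' : W ≃L[ℝ] W', HasFDerivAt Φ (L' : W →L[ℝ] W') y := by
  have hO' : IsOpen (O ∩ fderiv ℝ Φ ⁻¹' Set.range ((↑) : (W ≃L[ℝ] W') → W →L[ℝ] W')) :=
    hO.inter (ContinuousLinearEquiv.isOpen.preimage (hΦ.continuous_fderiv (by simp)))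
  let e := (hΦ.contDiffAt.toOpenPartialHomeomorph Φ hL (by simp)).restrOpen _ hO'
  have he : (e : W → W') = Φ := hΦ.contDiffAt.toOpenPartialHomeomorph_coe hL (by simp)
  have hxe : x ∈ e.source :=
    ⟨hΦ.contDiffAt.mem_toOpenPartialHomeomorph_source hL (by simp), hx, L, hL.fderiv.symm⟩
  have hderiv : ∀ y ∈ e.source, ∃ L' : W ≃L[ℝ] W', HasFDerivAt Φ (L' : W →L[ℝ] W') y := by
    rintro y ⟨-, -, L', hL'⟩
    exact ⟨L', hL' ▸ (hΦ.differentiable (by simp) y).hasFDerivAt⟩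
  refine ⟨e, he, hxe, fun y hy => hy.2.1, fun z hz => ?_, hderiv⟩
  obtain ⟨L', hL'⟩ := hderiv _ (e.map_target hz)
  exact (e.contDiffAt_symm hz (he ▸ hL') (he ▸ hΦ.contDiffAt)).contDiffWithinAt

variable {V : Type*} [NormedAddCommGroup V] [InnerProductSpace ℝ V]

section TangentSpace

variable {G : Type*} [NormedAddCommGroup G] [NormedSpace ℝ G] {M N : Set V} {x v : V} {γ : ℝ → V}

/-- `γ` is one of the smooth curves in `M` through `x`, with velocity `v`, whose velocities span
`tangentSpace M x`. -/
structure IsCurveThrough (M : Set V) (x v : V) (γ : ℝ → V) : Prop where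
  smooth : ContDiffAt ℝ ∞ γ 0
  zero : γ 0 = x
  mem : ∀ᶠ t in 𝓝 (0 : ℝ), γ t ∈ M
  deriv : deriv γ 0 = v

theorem IsCurveThrough.hasDerivAt (h : IsCurveThrough M x v γ) : HasDerivAt γ v 0 :=
  h.deriv ▸ (h.smooth.differentiableAt (by simp)).hasDerivAt

theorem IsCurveThrough.tendsto (h : IsCurveThrough M x v γ) : Tendsto γ (𝓝 0) (𝓝[M] x) :=
  tendsto_nhdsWithin_iff.2 ⟨h.zero ▸ h.smooth.continuousAt, h.mem⟩

theorem IsCurveThrough.mem_tangentSpace (h : IsCurveThrough M x v γ) : v ∈ tangentSpace M x :=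
  Submodule.subset_span ⟨γ, h.smooth, h.zero, h.mem, h.deriv⟩

theorem IsCurveThrough.comp_hasDerivAt (h : IsCurveThrough M x v γ) {Φ : V → G} {Φ' : V →L[ℝ] G}
    (hΦ : HasFDerivWithinAt Φ Φ' M x) : HasDerivAt (Φ ∘ γ) (Φ' v) 0 :=
  hΦ.comp_hasDerivAt_of_eq 0 h.hasDerivAt h.mem h.zero.symm

theorem IsCurveThrough.map (h : IsCurveThrough M x v γ) (σ : V →L[ℝ] V) (hσ : Set.MapsTo σ M N) :
    IsCurveThrough N (σ x) (σ v) (σ ∘ γ) where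
  smooth := σ.contDiff.contDiffAt.comp 0 h.smooth
  zero := by simp [h.zero]
  mem := h.mem.mono fun t ht => hσ ht
  deriv := (σ.hasFDerivAt.comp_hasDerivAt 0 h.hasDerivAt).deriv

theorem tangentSpace_le_iff {P : Submodule ℝ V} :
    tangentSpace M x ≤ P ↔ ∀ v γ, IsCurveThrough M x v γ → v ∈ P := by
  refine ⟨fun h v γ hγ => h hγ.mem_tangentSpace, fun h => Submodule.span_le.2 ?_⟩
  rintro v ⟨γ, smooth, zero, mem, deriv⟩
  exact h v γ ⟨smooth, zero, mem, deriv⟩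

theorem map_mem_tangentSpace (σ : V →L[ℝ] V) (hσ : Set.MapsTo σ M N)
    (hv : v ∈ tangentSpace M x) : σ v ∈ tangentSpace N (σ x) :=
  (tangentSpace_le_iff (P := (tangentSpace N (σ x)).comap (σ : V →ₗ[ℝ] V))).2
    (fun _ _ hγ => (hγ.map σ hσ).mem_tangentSpace) hv

theorem hasFDerivWithinAt_eqOn_tangentSpace {Φ : V → G} {Φ' Φ'' : V →L[ℝ] G}
    (h' : HasFDerivWithinAt Φ Φ' M x) (h'' : HasFDerivWithinAt Φ Φ'' M x) :
    Set.EqOn Φ' Φ'' (tangentSpace M x) := by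
  have hle : tangentSpace M x ≤ (Φ' - Φ'').ker := tangentSpace_le_iff.2 fun v γ hγ => by
    simpa [sub_eq_zero] using (hγ.comp_hasDerivAt h').unique (hγ.comp_hasDerivAt h'')
  exact fun v hv => by simpa [sub_eq_zero] using hle hv

theorem differential_apply {Φ : V → G} {Φ' : V →L[ℝ] G} (h' : HasFDerivWithinAt Φ Φ' M x)
    (v : tangentSpace M x) : differential M Φ x v = Φ' v :=
  hasFDerivWithinAt_eqOn_tangentSpace h'.differentiableWithinAt.hasFDerivWithinAt h' v.2

variable [FiniteDimensional ℝ V]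

theorem inner_shapeOperator {ξ : V → V} {ξ' : V →L[ℝ] V} (hξ : HasFDerivWithinAt ξ ξ' M x)
    (X Y : tangentSpace M x) :
    inner ℝ (shapeOperator M ξ x X) Y = -inner ℝ (ξ' X) (Y : V) := by
  simp only [shapeOperator, neg_apply, ContinuousLinearMap.comp_apply, inner_neg_left,
    differential_apply hξ, Submodule.inner_orthogonalProjectionOnto_eq_of_mem_right]

theorem normalDerivative_eq_zero {ξ : V → V} (hξ : DifferentiableWithinAt ℝ ξ M x)
    (h : ∀ X γ, IsCurveThrough M x X γ → ∀ D, HasDerivAt (ξ ∘ γ) D 0 →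
      ∀ v ∈ normalSpace N M x, inner ℝ v D = 0) : normalDerivative N M ξ x = 0 := by
  obtain ⟨ξ', hξ'⟩ := hξ
  have hle : ∀ v ∈ normalSpace N M x, tangentSpace M x ≤ (innerSL ℝ v ∘L ξ').ker := fun v hv =>
    tangentSpace_le_iff.2 fun X γ hγ => h X γ hγ _ (hγ.comp_hasDerivAt hξ') v hv
  ext1 X
  refine ext_inner_right ℝ fun v => ?_
  rw [normalDerivative, ContinuousLinearMap.comp_apply, differential_apply hξ',
    Submodule.inner_orthogonalProjectionOnto_eq_of_mem_right, zero_apply, inner_zero_left,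
    real_inner_comm]
  exact hle v v.2 X.2

end TangentSpace

variable {V W : Type*} [NormedAddCommGroup V] [InnerProductSpace ℝ V] [NormedAddCommGroup W]
  [NormedSpace ℝ W] {M O : Set V} {G : V → W} {x : V}

/-- A chart `e` around `x`, with values in `V` itself and derivative the identity at `x`, in which
`G` becomes, up to the constant `G x`, the linear map `fderiv ℝ G x`. -/
structure IsStraightening (O : Set V) (G : V → W) (x : V) (e : OpenPartialHomeomorph V V) :
    Prop where
  mem_source : x ∈ e.source
  source_subset : e.source ⊆ O
  contDiff : ContDiff ℝ ∞ e
  contDiffOn_symm : ContDiffOn ℝ ∞ e.symm e.target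
  apply_self : e x = 0
  hasFDerivAt_self : HasFDerivAt e (ContinuousLinearMap.id ℝ V) x
  exists_hasFDerivAt : ∀ y ∈ e.source, ∃ L : V ≃L[ℝ] V, HasFDerivAt e (L : V →L[ℝ] V) y
  fderiv_apply : ∀ y, fderiv ℝ G x (e y) = G y - G x

theorem IsStraightening.fderiv_fderiv_apply {e : OpenPartialHomeomorph V V}
    (he : IsStraightening O G x e) (y v : V) :
    fderiv ℝ G x (fderiv ℝ e y v) = fderiv ℝ G y v := by
  have hcomp : fderiv ℝ G x ∘ e = fun y => G y - G x := funext he.fderiv_apply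
  have hderiv := ((fderiv ℝ G x).hasFDerivAt.comp y
    (he.contDiff.differentiable (by simp) y).hasFDerivAt).fderiv
  rw [hcomp, fderiv_sub_const] at hderiv
  exact congr($hderiv v).symm

theorem exists_isStraightening [CompleteSpace V] [FiniteDimensional ℝ W] (hG : ContDiff ℝ ∞ G)
    (hx : Function.Surjective (fderiv ℝ G x)) (hO : IsOpen O) (hxO : x ∈ O) :
    ∃ e, IsStraightening O G x e := by
  set D := fderiv ℝ G x
  obtain ⟨R, hR⟩ := D.exists_rightInverse_of_surjective (LinearMap.range_eq_top.2 hx)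
  let Φ : V → V := fun y => (y - x) + R (G y - G x - D (y - x))
  have hΦ : ContDiff ℝ ∞ Φ := by fun_prop
  have hDΦ : ∀ y, D (Φ y) = G y - G x := fun y => by
    have hDR : ∀ z, D (R z) = z := fun z => congr($hR z)
    simp [Φ, hDR]
  have hΦx : HasFDerivAt Φ (ContinuousLinearMap.id ℝ V) x := by
    have hsub : HasFDerivAt (· - x) (ContinuousLinearMap.id ℝ V) x :=
      (hasFDerivAt_id x).sub_const x
    have hG' := (hG.differentiable (by simp) x).hasFDerivAt.sub_const (G x)
    have := hsub.add (R.hasFDerivAt.comp x (hG'.sub (D.hasFDerivAt.comp x hsub)))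
    rwa [ContinuousLinearMap.comp_id, sub_self, ContinuousLinearMap.comp_zero, add_zero] at this
  obtain ⟨e, he, hxe, heO, hes, hei⟩ :=
    exists_smooth_local_inverse hΦ (ContinuousLinearEquiv.refl ℝ V) hΦx hO hxO
  exact ⟨e, hxe, heO, he ▸ hΦ, hes, by simp [he, Φ], he ▸ hΦx, he ▸ hei, he ▸ hDΦ⟩

/-- `M` is locally, within the open set `O`, a level set of `G`, all of whose points are regular
points of `G`. -/
structure IsRegularLevelSet (M O : Set V) (G : V → W) : Prop where
  isOpen : IsOpen O
  contDiff : ContDiff ℝ ∞ G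
  mem_iff : ∀ x ∈ M, ∀ y, y ∈ M ↔ y ∈ O ∧ G y = G x
  surjective : ∀ x ∈ M, Function.Surjective (fderiv ℝ G x)

namespace IsRegularLevelSet

theorem mem_iff_apply_mem_ker (h : IsRegularLevelSet M O G) (hx : x ∈ M)
    {e : OpenPartialHomeomorph V V} (he : IsStraightening O G x e) {y : V} (hy : y ∈ e.source) :
    y ∈ M ↔ e y ∈ (fderiv ℝ G x).ker := by
  rw [h.mem_iff x hx y, LinearMap.mem_ker]
  simp [he.fderiv_apply, sub_eq_zero, he.source_subset hy]

variable [FiniteDimensional ℝ W]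

theorem exists_isStraightening [CompleteSpace V] (h : IsRegularLevelSet M O G) (hx : x ∈ M) :
    ∃ e, IsStraightening O G x e :=
  EuclideanSubmanifold.exists_isStraightening h.contDiff (h.surjective x hx) h.isOpen
    ((h.mem_iff x hx x).1 hx).1

theorem exists_curve [CompleteSpace V] (h : IsRegularLevelSet M O G) (hx : x ∈ M) {v : V}
    (hv : fderiv ℝ G x v = 0) : ∃ γ, IsCurveThrough M x v γ := by
  obtain ⟨e, he⟩ := h.exists_isStraightening hx
  have h0 : (0 : V) ∈ e.target := he.apply_self ▸ e.map_source he.mem_source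
  have hsymm0 : e.symm 0 = x := by rw [← he.apply_self, e.left_inv he.mem_source]
  have hline : HasDerivAt (fun t : ℝ => t • v) v 0 := by
    simpa using (hasDerivAt_id (0 : ℝ)).smul_const v
  have hsymm : HasFDerivAt e.symm (ContinuousLinearMap.id ℝ V) 0 :=
    e.hasFDerivAt_symm (f' := ContinuousLinearEquiv.refl ℝ V) h0 (hsymm0 ▸ he.hasFDerivAt_self)
  have htarget : ∀ᶠ t in 𝓝 (0 : ℝ), t • v ∈ e.target :=
    hline.continuousAt.eventually_mem (by simpa using e.open_target.mem_nhds h0)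
  refine ⟨e.symm ∘ fun t : ℝ => t • v, ?_, by simp [hsymm0], ?_,
    (HasFDerivAt.comp_hasDerivAt_of_eq (0 : ℝ) hsymm hline (zero_smul ℝ v).symm).deriv⟩
  · have hsmooth := (he.contDiffOn_symm 0 h0).contDiffAt (e.open_target.mem_nhds h0)
    exact ContDiffAt.comp 0 ((zero_smul ℝ v).symm ▸ hsmooth) (by fun_prop)
  · filter_upwards [htarget] with t ht
    rw [Function.comp_apply, h.mem_iff_apply_mem_ker hx he (e.map_target ht), e.right_inv ht]
    simp [hv]

theorem tangentSpace_eq [CompleteSpace V] (h : IsRegularLevelSet M O G) (hx : x ∈ M) :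
    tangentSpace M x = (fderiv ℝ G x).ker := by
  refine le_antisymm (tangentSpace_le_iff.2 fun v γ hγ => ?_) fun v hv => ?_
  · have hderiv := hγ.comp_hasDerivAt
      (h.contDiff.differentiable (by simp) x).hasFDerivAt.hasFDerivWithinAt
    have hconst : (G ∘ γ) =ᶠ[𝓝 0] fun _ => G x :=
      hγ.mem.mono fun t ht => ((h.mem_iff x hx _).1 ht).2
    exact (hderiv.congr_of_eventuallyEq hconst.symm).unique (hasDerivAt_const (0 : ℝ) (G x))
  · obtain ⟨γ, hγ⟩ := h.exists_curve hx hv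
    exact hγ.mem_tangentSpace

theorem exists_tendsto_mem_tangentSpace [CompleteSpace V] (h : IsRegularLevelSet M O G)
    (hx : x ∈ M) {Y : V} (hY : Y ∈ tangentSpace M x) :
    ∃ Z : V → V, Tendsto Z (𝓝 x) (𝓝 Y) ∧ ∀ᶠ y in 𝓝[M] x, Z y ∈ tangentSpace M y := by
  obtain ⟨e, he⟩ := h.exists_isStraightening hx
  have hinv : ContinuousAt (fun y => (fderiv ℝ e y).inverse) x := by
    refine ContinuousAt.comp (g := ContinuousLinearMap.inverse) ?_
      (he.contDiff.continuous_fderiv (by simp)).continuousAt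
    rw [he.hasFDerivAt_self.fderiv]
    exact (contDiffAt_map_inverse (n := ∞) (ContinuousLinearEquiv.refl ℝ V)).continuousAt
  have hinvx : (fderiv ℝ e x).inverse Y = Y := by
    rw [he.hasFDerivAt_self.fderiv, ContinuousLinearMap.inverse_id, ContinuousLinearMap.id_apply]
  have hlim := (hinv.clm_apply (continuousAt_const (y := Y))).tendsto
  rw [hinvx] at hlim
  refine ⟨fun y => (fderiv ℝ e y).inverse Y, hlim, ?_⟩
  filter_upwards [self_mem_nhdsWithin,
    mem_nhdsWithin_of_mem_nhds (e.open_source.mem_nhds he.mem_source)] with y hyM hye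
  obtain ⟨L, hL⟩ := he.exists_hasFDerivAt y hye
  rw [h.tangentSpace_eq hx] at hY
  rw [h.tangentSpace_eq hyM, LinearMap.mem_ker, ContinuousLinearMap.coe_coe,
    ← he.fderiv_fderiv_apply, hL.fderiv]
  simpa using hY

theorem inner_fderivWithin_eq_zero [CompleteSpace V] (h : IsRegularLevelSet M O G) (hx : x ∈ M)
    {ζ : V → V} {ζ' : V →L[ℝ] V} (hζ : HasFDerivWithinAt ζ ζ' M x) (h0 : ζ x = 0)
    (hnormal : ∀ᶠ y in 𝓝[M] x, ζ y ∈ (tangentSpace M y)ᗮ) {X Y : V}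
    (hX : X ∈ tangentSpace M x) (hY : Y ∈ tangentSpace M x) : inner ℝ (ζ' X) Y = 0 := by
  suffices tangentSpace M x ≤ (innerSL ℝ Y ∘L ζ').ker by
    rw [real_inner_comm]
    exact this hX
  refine tangentSpace_le_iff.2 fun v γ hγ => ?_
  obtain ⟨Z, hZ, hZM⟩ := h.exists_tendsto_mem_tangentSpace hx hY
  have hzero : ∀ᶠ t in 𝓝 (0 : ℝ), inner ℝ (Z (γ t)) (ζ (γ t)) = 0 := by
    filter_upwards [hγ.tendsto.eventually hnormal, hγ.tendsto.eventually hZM] with t hζt hZt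
    exact hζt _ hZt
  have hslope := hasDerivAt_iff_tendsto_slope_zero.1 (hγ.comp_hasDerivAt hζ)
  have hZγ : Tendsto (fun t => Z (γ t)) (𝓝[≠] 0) (𝓝 Y) :=
    hZ.comp ((tendsto_nhds_of_tendsto_nhdsWithin hγ.tendsto).mono_left nhdsWithin_le_nhds)
  refine tendsto_nhds_unique (hZγ.inner (𝕜 := ℝ) hslope) (tendsto_const_nhds.congr' ?_)
  filter_upwards [nhdsWithin_le_nhds hzero] with t ht
  simp [hγ.zero, h0, inner_smul_right, ht]

theorem isSubmanifold [FiniteDimensional ℝ V] (h : IsRegularLevelSet M O G) {d : ℕ}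
    (hd : d + Module.finrank ℝ W = Module.finrank ℝ V) : IsSubmanifold M d := by
  intro x hx
  obtain ⟨e, he⟩ := h.exists_isStraightening hx
  have hrank := LinearMap.finrank_range_add_finrank_ker (fderiv ℝ G x : V →ₗ[ℝ] W)
  rw [LinearMap.range_eq_top.2 (h.surjective x hx), finrank_top] at hrank
  exact ⟨(fderiv ℝ G x).ker, e, by omega, he.mem_source, he.contDiff.contDiffOn,
    he.contDiffOn_symm, fun y hy => h.mem_iff_apply_mem_ker hx he hy⟩

end IsRegularLevelSet

section Orientation

theorem contDiffOn_curryLeft {d : ℕ} {η : V → V [⋀^Fin (d + 1)]→L[ℝ] ℝ} {a : V → V}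
    (hη : ContDiffOn ℝ ∞ η M) (ha : ContDiffOn ℝ ∞ a M) :
    ContDiffOn ℝ ∞ (fun x => (η x).curryLeft (a x)) M := by
  have hbilinear : IsBoundedBilinearMap ℝ fun q : (V [⋀^Fin (d + 1)]→L[ℝ] ℝ) × V =>
      q.1.curryLeft q.2 :=
    { add_left _ _ _ := by simp
      smul_left _ _ _ := by simp
      add_right _ _ _ := by simp
      smul_right _ _ _ := by simp
      bound := ⟨1, one_pos, fun η v => by
        rw [one_mul, ← ContinuousAlternatingMap.norm_curryLeft η]
        exact η.curryLeft.le_opNorm v⟩ }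
  exact hbilinear.contDiff.comp_contDiffOn (hη.prodMk ha)

theorem exists_curried_form {d : ℕ} : ∀ (k : ℕ) (η : V → V [⋀^Fin (d + k)]→L[ℝ] ℝ)
    (_ : ContDiffOn ℝ ∞ η M) (a : Fin k → V → V) (_ : ∀ i, ContDiffOn ℝ ∞ (a i) M),
    ∃ η' : V → V [⋀^Fin d]→L[ℝ] ℝ, ContDiffOn ℝ ∞ η' M ∧ ∀ x v, ∃ w : Fin (d + k) → V,
      η' x v = η x w ∧ Set.range w = Set.range v ∪ Set.range fun i => a i x
  | 0, η, hη, _, _ => ⟨η, hη, fun _ v => ⟨v, rfl, by simp⟩⟩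
  | k + 1, η, hη, a, ha => by
    obtain ⟨η', hη', hcurry⟩ := exists_curried_form k _ (contDiffOn_curryLeft hη (ha 0))
      (fun i => a i.succ) fun i => ha _
    refine ⟨η', hη', fun x v => ?_⟩
    obtain ⟨w, hw, hrange⟩ := hcurry x v
    refine ⟨Matrix.vecCons (a 0 x) w, hw, ?_⟩
    rw [Matrix.range_cons, hrange]
    ext y
    simp only [Set.mem_union, Set.mem_range, Set.mem_singleton_iff, Fin.exists_fin_succ]
    tauto

variable [FiniteDimensional ℝ V]

theorem exists_alternating_apply_ne_zero {n : ℕ} (hn : Module.finrank ℝ V = n) :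
    ∃ vol : V [⋀^Fin n]→L[ℝ] ℝ, ∀ w, Submodule.span ℝ (Set.range w) = ⊤ → vol w ≠ 0 := by
  let b := Module.finBasisOfFinrankEq ℝ V hn
  have hcont : Continuous b.det := by
    refine Continuous.matrix_det (continuous_matrix fun i j => ?_)
    exact (LinearMap.continuous_of_finiteDimensional (b.coord i)).comp (continuous_apply j)
  refine ⟨{ b.det with cont := hcont }, fun w hw => ?_⟩
  have hli : LinearIndependent ℝ w :=
    linearIndependent_of_top_le_span_of_card_eq_finrank hw.ge (by simp [hn])
  have hdet := (b.isUnit_det (Module.Basis.mk hli hw.ge)).ne_zero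
  rwa [Module.Basis.coe_mk] at hdet

theorem isOrientable_of_normalFrame {d k : ℕ} (hd : d + k = Module.finrank ℝ V)
    (a : Fin k → V → V) (ha : ∀ i, ContDiffOn ℝ ∞ (a i) M)
    (hli : ∀ x ∈ M, LinearIndependent ℝ fun i => a i x)
    (hT : ∀ x ∈ M, tangentSpace M x = (Submodule.span ℝ (Set.range fun i => a i x))ᗮ) :
    IsOrientable M d := by
  obtain ⟨vol, hvol⟩ := exists_alternating_apply_ne_zero hd.symm
  obtain ⟨η, hη, hcurry⟩ := exists_curried_form k (fun _ => vol) contDiffOn_const a ha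
  refine ⟨η, hη, fun x hx => ?_⟩
  set P := Submodule.span ℝ (Set.range fun i => a i x)
  have hP : Module.finrank ℝ P = k := by simpa using finrank_span_eq_card (hli x hx)
  have hPd : Module.finrank ℝ Pᗮ = d := by
    have := P.finrank_add_finrank_orthogonal
    omega
  let c := Module.finBasisOfFinrankEq ℝ Pᗮ hPd
  have hc : Submodule.span ℝ (Set.range fun i => (c i : V)) = Pᗮ := by
    have := congrArg (Submodule.map Pᗮ.subtype) c.span_eq
    rwa [Submodule.map_span, ← Set.range_comp, Submodule.map_top, Submodule.range_subtype] at this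
  obtain ⟨w, hw, hrange⟩ := hcurry x fun i => (c i : V)
  refine ⟨fun i => c i, fun i => (hT x hx).symm ▸ (c i).2, ?_⟩
  rw [hw]
  refine hvol w ?_
  rw [hrange, Submodule.span_union, hc, sup_comm]
  exact Submodule.sup_orthogonal_of_hasOrthogonalProjection

theorem IsRegularLevelSet.isOrientable [FiniteDimensional ℝ W] (h : IsRegularLevelSet M O G)
    {d : ℕ} (hd : d + Module.finrank ℝ W = Module.finrank ℝ V) : IsOrientable M d := by
  let b := Module.finBasis ℝ W
  let coord (i) : W →L[ℝ] ℝ := LinearMap.toContinuousLinearMap (b.coord i)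
  let grad (i) (x : V) : V := (InnerProductSpace.toDual ℝ V).symm (coord i ∘L fderiv ℝ G x)
  have hgrad : ∀ i x X, inner ℝ (grad i x) X = b.repr (fderiv ℝ G x X) i := fun i x X => by
    simp [grad, coord]
  refine isOrientable_of_normalFrame hd grad (fun i => ?_) (fun x hx => ?_) fun x hx => ?_
  · have := h.contDiff.fderiv_right (m := ∞) le_rfl
    exact ((InnerProductSpace.toDual ℝ V).symm.contDiff.comp
      (contDiff_const.clm_comp this)).contDiffOn
  · rw [← surjective_inner_iff_linearIndependent]
    simp only [hgrad]
    exact b.equivFun.surjective.comp (h.surjective x hx)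
  · ext X
    rw [mem_orthogonal_span_range_iff, h.tangentSpace_eq hx, LinearMap.mem_ker,
      ← b.repr.map_eq_zero_iff, Finsupp.ext_iff]
    simp [hgrad]

end Orientation

section Austere

variable [FiniteDimensional ℝ V] [FiniteDimensional ℝ W]

theorem IsRegularLevelSet.inner_fderivWithin_isometry (h : IsRegularLevelSet M O G) (hx : x ∈ M)
    (σ : V ≃ₗᵢ[ℝ] V) (hσM : Set.MapsTo σ M M) (hσx : σ x = x) {U : Set V} (hU : IsOpen U)
    (hxU : x ∈ U) {ξ : V → V} {ξ' : V →L[ℝ] V} (hξ : HasFDerivWithinAt ξ ξ' M x)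
    (hnormal : ∀ y ∈ M ∩ U, ξ y ∈ (tangentSpace M y)ᗮ) (hξx : σ (ξ x) = -ξ x) {X Y : V}
    (hX : X ∈ tangentSpace M x) (hY : Y ∈ tangentSpace M x) :
    inner ℝ (ξ' (σ X)) (σ Y) = -inner ℝ (ξ' X) Y := by
  let σL : V →L[ℝ] V := σ.toContinuousLinearEquiv
  let ρ : V →L[ℝ] V := σ.symm.toContinuousLinearEquiv
  have hζ : HasFDerivWithinAt (fun y => ξ y + ρ (ξ (σ y))) (ξ' + ρ ∘L ξ' ∘L σL) M x := by
    refine hξ.add (ρ.hasFDerivAt.comp_hasFDerivWithinAt x ?_)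
    exact HasFDerivWithinAt.comp x (hσx.symm ▸ hξ) σL.hasFDerivAt.hasFDerivWithinAt hσM
  have hζx : ξ x + ρ (ξ (σ x)) = 0 := by
    have hρξ : ρ (ξ x) = -ξ x := σ.injective (by simp [ρ, hξx])
    rw [hσx, hρξ, add_neg_cancel]
  have hζnormal : ∀ᶠ y in 𝓝[M] x, ξ y + ρ (ξ (σ y)) ∈ (tangentSpace M y)ᗮ := by
    have hmem : ∀ᶠ y in 𝓝[M] x, y ∈ U ∧ σ y ∈ U :=
      mem_nhdsWithin_of_mem_nhds (inter_mem (hU.mem_nhds hxU)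
        (σ.continuous.continuousAt.preimage_mem_nhds (hU.mem_nhds (hσx.symm ▸ hxU))))
    filter_upwards [self_mem_nhdsWithin, hmem] with y hyM hyU
    refine Submodule.add_mem _ (hnormal y ⟨hyM, hyU.1⟩) fun t ht => ?_
    rw [← σ.inner_map_map]
    simpa [ρ] using hnormal (σ y) ⟨hσM hyM, hyU.2⟩ (σ t) (map_mem_tangentSpace σL hσM ht)
  have hzero := h.inner_fderivWithin_eq_zero hx hζ hζx hζnormal hX hY
  have hρ : inner ℝ (ρ (ξ' (σ X))) Y = inner ℝ (ξ' (σ X)) (σ Y) := by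
    rw [← σ.inner_map_map]
    simp [ρ]
  rw [add_apply, inner_add_left] at hzero
  exact hρ.symm.trans (eq_neg_of_add_eq_zero_right hzero)

theorem IsRegularLevelSet.isAustere (h : IsRegularLevelSet M O G) {N : Set V}
    (hσ : ∀ x ∈ M, ∃ σ : V ≃ₗᵢ[ℝ] V, Set.MapsTo σ M M ∧ σ x = x ∧
      ∀ v ∈ normalSpace N M x, σ v = -v) : IsAustere N M := by
  intro U ξ hU hξ x hx c
  obtain ⟨σ, hσM, hσx, hσξ⟩ := hσ x hx.1
  obtain ⟨ξ', hξ'⟩ := hξ.smooth.differentiableOn (by simp) x hx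
  replace hξ' : HasFDerivWithinAt ξ ξ' M x :=
    hξ'.mono_of_mem_nhdsWithin (inter_mem_nhdsWithin M (hU.mem_nhds hx.2))
  have hσT : ∀ Y ∈ tangentSpace M x, σ.toLinearEquiv Y ∈ tangentSpace M x := fun Y hY => by
    simpa [hσx] using map_mem_tangentSpace (σ : V →L[ℝ] V) hσM hY
  let τ := (σ.toLinearEquiv : V →ₗ[ℝ] V).restrict hσT
  have hτ : Function.Injective τ := fun X Y hXY => Subtype.ext (σ.injective congr(($hXY : V)))
  have hinner : ∀ X Y, inner ℝ (τ X) (τ Y) = inner ℝ X Y := fun X Y => σ.inner_map_map X Y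
  refine finrank_eigenspace_eq_finrank_eigenspace_neg hτ (fun X => ext_inner_right ℝ fun Y => ?_) c
  obtain ⟨Y, rfl⟩ := LinearMap.injective_iff_surjective.1 hτ Y
  rw [inner_neg_left, hinner, ContinuousLinearMap.coe_coe, inner_shapeOperator hξ',
    inner_shapeOperator hξ', neg_inj]
  exact h.inner_fderivWithin_isometry hx.1 σ hσM hσx hU hx.2 hξ' (fun y hy => (hξ.normal y hy).2)
    (hσξ _ (hξ.normal x hx)) X.2 Y.2

end Austere

section UnitSphere

variable {Ψ : V → W} {A X : V}

theorem isRegularLevelSet_sphere :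
    IsRegularLevelSet (Metric.sphere (0 : V) 1) Set.univ fun A => ‖A‖ ^ 2 where
  isOpen := isOpen_univ
  contDiff := contDiff_norm_sq ℝ
  mem_iff A hA B := by
    rw [mem_sphere_zero_iff_norm] at hA ⊢
    simp [hA, pow_eq_one_iff_of_nonneg (norm_nonneg B) two_ne_zero]
  surjective A hA r := ⟨(r / 2) • A, by
    rw [mem_sphere_zero_iff_norm] at hA
    simp [hA]⟩

/-- The regular points of the restriction of `Ψ` to the unit sphere at which `Ψ` vanishes. -/
def regularSet (Ψ : V → W) : Set V :=
  {A | A ∈ Metric.sphere 0 1 ∧ Ψ A = 0 ∧ IsRegularPoint (Metric.sphere 0 1) Ψ A}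

theorem fderiv_norm_sq_prodMk_apply (hΨ : ContDiff ℝ ∞ Ψ) :
    fderiv ℝ (fun A => (‖A‖ ^ 2, Ψ A)) A X = (2 * inner ℝ A X, fderiv ℝ Ψ A X) := by
  rw [DifferentiableAt.fderiv_prodMk ((contDiff_norm_sq ℝ).differentiable one_ne_zero A)
    (hΨ.differentiable (by simp) A)]
  simp

variable [CompleteSpace V]

theorem mem_tangentSpace_sphere (hA : ‖A‖ = 1) :
    X ∈ tangentSpace (Metric.sphere 0 1) A ↔ inner ℝ A X = 0 := by
  rw [isRegularLevelSet_sphere.tangentSpace_eq (mem_sphere_zero_iff_norm.2 hA)]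
  simp

theorem isRegularPoint_sphere_iff (hΨ : DifferentiableAt ℝ Ψ A) (hA : ‖A‖ = 1)
    (hEuler : fderiv ℝ Ψ A A = 0) : IsRegularPoint (Metric.sphere 0 1) Ψ A ↔
      Function.Surjective (fderiv ℝ Ψ A) := by
  have hdiff := differential_apply (M := Metric.sphere 0 1) hΨ.hasFDerivAt.hasFDerivWithinAt
  refine ⟨fun h c => ?_, fun h c => ?_⟩
  · obtain ⟨X, hX⟩ := h c
    exact ⟨X, by rw [← hdiff, hX]⟩
  · obtain ⟨X, rfl⟩ := h c
    refine ⟨⟨X - inner ℝ A X • A, (mem_tangentSpace_sphere hA).2 ?_⟩, ?_⟩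
    · simp [inner_sub_right, inner_smul_right, hA]
    · rw [hdiff]
      simp [hEuler]

theorem mem_regularSet_iff (hΨ : Differentiable ℝ Ψ)
    (hEuler : ∀ A, Ψ A = 0 → fderiv ℝ Ψ A A = 0) :
    A ∈ regularSet Ψ ↔ ‖A‖ = 1 ∧ Ψ A = 0 ∧ Function.Surjective (fderiv ℝ Ψ A) := by
  rw [regularSet, Set.mem_ofPred_eq, mem_sphere_zero_iff_norm]
  refine and_congr_right fun hA => and_congr_right fun h0 => ?_
  exact isRegularPoint_sphere_iff (hΨ A) hA (hEuler A h0)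

variable (hΨ : ContDiff ℝ ∞ Ψ) (hEuler : ∀ A, Ψ A = 0 → fderiv ℝ Ψ A A = 0)

include hΨ hEuler

theorem isRegularLevelSet_regularSet [FiniteDimensional ℝ W] :
    IsRegularLevelSet (regularSet Ψ) {A | Function.Surjective (fderiv ℝ Ψ A)}
      fun A => (‖A‖ ^ 2, Ψ A) where
  isOpen := isOpen_setOf_surjective.preimage (hΨ.continuous_fderiv (by simp))
  contDiff := (contDiff_norm_sq ℝ).prodMk hΨ
  mem_iff A hA B := by
    rw [mem_regularSet_iff (hΨ.differentiable (by simp)) hEuler] at hA ⊢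
    simp [hA.1, hA.2.1, pow_eq_one_iff_of_nonneg (norm_nonneg B) two_ne_zero]
    tauto
  surjective A hA c := by
    rw [mem_regularSet_iff (hΨ.differentiable (by simp)) hEuler] at hA
    obtain ⟨X, hX⟩ := hA.2.2 c.2
    refine ⟨X + (c.1 / 2 - inner ℝ A X) • A, ?_⟩
    rw [fderiv_norm_sq_prodMk_apply hΨ]
    ext1
    · simp [inner_add_right, inner_smul_right, hA.1]
      ring
    · simp [hX, hEuler A hA.2.1]

theorem mem_tangentSpace_regularSet_iff [FiniteDimensional ℝ W] (hA : A ∈ regularSet Ψ) :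
    X ∈ tangentSpace (regularSet Ψ) A ↔ inner ℝ A X = 0 ∧ fderiv ℝ Ψ A X = 0 := by
  rw [(isRegularLevelSet_regularSet hΨ hEuler).tangentSpace_eq hA, LinearMap.mem_ker,
    ContinuousLinearMap.coe_coe, fderiv_norm_sq_prodMk_apply hΨ]
  simp [Prod.ext_iff]

theorem normalSpace_regularSet [FiniteDimensional ℝ W] (hA : A ∈ regularSet Ψ) :
    normalSpace (Metric.sphere 0 1) (regularSet Ψ) A = (fderiv ℝ Ψ A).kerᗮ := by
  have hA' := (mem_regularSet_iff (hΨ.differentiable (by simp)) hEuler).1 hA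
  ext X
  rw [normalSpace, Submodule.mem_inf, mem_tangentSpace_sphere hA'.1, Submodule.mem_orthogonal,
    Submodule.mem_orthogonal]
  simp only [mem_tangentSpace_regularSet_iff hΨ hEuler hA]
  refine ⟨fun h Y hY => ?_, fun h => ⟨?_, fun Y hY => h Y hY.2⟩⟩
  · have := h.2 (Y - inner ℝ A Y • A)
      ⟨by simp [inner_sub_right, inner_smul_right, hA'.1], by
        simpa [hEuler A hA'.2.1] using hY⟩
    simpa [inner_sub_left, inner_smul_left, h.1] using this
  · exact h A (hEuler A hA'.2.1)

end UnitSphere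

theorem isFull_of_forall_inner_eq_zero [FiniteDimensional ℝ V]
    (h : ∀ X, (∀ A ∈ M, inner ℝ A X = 0) → X = 0) : IsFull M := by
  intro W hW
  rw [← Submodule.orthogonal_eq_bot_iff, Submodule.eq_bot_iff]
  exact fun X hX => h X fun A hA => hX A (hW hA)

end EuclideanSubmanifold

namespace HermitianSphere

open EuclideanSubmanifold

section NewtonIdentities

theorem aeval_esymm_eq_of_sum_pow_eq {σ R : Type*} [Fintype σ] [CommRing R] [IsDomain R]
    [CharZero R] {a b : σ → R} {m : ℕ} (h : ∀ k, 1 ≤ k → k ≤ m → ∑ i, a i ^ k = ∑ i, b i ^ k)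
    (k : ℕ) (hk : k ≤ m) :
    MvPolynomial.aeval a (MvPolynomial.esymm σ R k) =
      MvPolynomial.aeval b (MvPolynomial.esymm σ R k) := by
  induction k using Nat.strong_induction_on with
  | _ k ih =>
    rcases Nat.eq_zero_or_pos k with rfl | hpos
    · simp
    have hnewton : ∀ x : σ → R, (k : R) * MvPolynomial.aeval x (MvPolynomial.esymm σ R k) =
        (-1) ^ (k + 1) * ∑ c ∈ Finset.HasAntidiagonal.antidiagonal k with (c : ℕ × ℕ).1 < k,
          (-1) ^ c.1 * MvPolynomial.aeval x (MvPolynomial.esymm σ R c.1) * ∑ i, x i ^ c.2 := by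
      intro x
      have hmul := congrArg (MvPolynomial.aeval x) (MvPolynomial.mul_esymm_eq_sum σ R k)
      simpa [MvPolynomial.psum] using hmul
    refine mul_left_cancel₀ (Nat.cast_ne_zero.2 hpos.ne' : (k : R) ≠ 0) ?_
    rw [hnewton, hnewton]
    congr 1
    refine Finset.sum_congr rfl fun c hc => ?_
    obtain ⟨hsum, hlt⟩ := Finset.mem_filter.1 hc
    rw [Finset.HasAntidiagonal.mem_antidiagonal] at hsum
    rw [ih c.1 hlt (by omega), h c.2 (by omega) (by omega)]

theorem multiset_map_eq_of_sum_pow_eq {σ R : Type*} [Fintype σ] [CommRing R] [IsDomain R]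
    [CharZero R] {a b : σ → R}
    (h : ∀ k, 1 ≤ k → k ≤ Fintype.card σ → ∑ i, a i ^ k = ∑ i, b i ^ k) :
    Finset.univ.val.map a = Finset.univ.val.map b := by
  have hesymm : ∀ k ≤ Fintype.card σ,
      (Finset.univ.val.map a).esymm k = (Finset.univ.val.map b).esymm k := by
    intro k hk
    simpa only [MvPolynomial.aeval_esymm_eq_multiset_esymm] using
      aeval_esymm_eq_of_sum_pow_eq h k hk
  have hprod : ((Finset.univ.val.map a).map fun t => Polynomial.X - Polynomial.C t).prod =
      ((Finset.univ.val.map b).map fun t => Polynomial.X - Polynomial.C t).prod := by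
    rw [Multiset.prod_X_sub_X_eq_sum_esymm, Multiset.prod_X_sub_X_eq_sum_esymm]
    simp only [Multiset.card_map]
    refine Finset.sum_congr rfl fun k hk => ?_
    rw [hesymm k (Nat.lt_succ_iff.1 (Finset.mem_range.1 hk))]
  rw [← Polynomial.roots_multiset_prod_X_sub_C (Finset.univ.val.map a), hprod,
    Polynomial.roots_multiset_prod_X_sub_C]

theorem eq_of_antitone_of_multiset_map_eq {α : Type*} [LinearOrder α] {n : ℕ} {a b : Fin n → α}
    (ha : Antitone a) (hb : Antitone b)
    (h : Finset.univ.val.map a = Finset.univ.val.map b) : a = b := by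
  have hperm : (List.ofFn a).Perm (List.ofFn b) := by
    rw [← Multiset.coe_eq_coe]
    simpa [Fin.univ_val_map] using h
  exact List.ofFn_inj.1
    (hperm.eq_of_pairwise' ha.sortedGE_ofFn.pairwise hb.sortedGE_ofFn.pairwise)

variable {n : ℕ} {a : Fin n → ℝ}

theorem sum_odd_pow_eq_zero (ha : ∀ i, a i.rev = -a i) {k : ℕ} (hk : Odd k) :
    ∑ i, a i ^ k = 0 := by
  have hneg : ∑ i, a i ^ k = -∑ i, a i ^ k := by
    conv_lhs => rw [← Equiv.sum_comp Fin.revPerm]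
    simp [ha, hk.neg_pow]
  linarith

theorem rev_eq_neg_of_sum_odd_pow_eq_zero (ha : Antitone a)
    (h : ∀ k, Odd k → k ≤ n → ∑ i, a i ^ k = 0) (i : Fin n) : a i.rev = -a i := by
  have hpow : ∀ k, 1 ≤ k → k ≤ Fintype.card (Fin n) →
      ∑ i, a i ^ k = ∑ i, (-a (Fin.rev i)) ^ k := by
    intro k _ hk
    rw [Fintype.card_fin] at hk
    have hreindex : ∑ i, (-a (Fin.rev i)) ^ k = ∑ i, (-a i) ^ k :=
      Equiv.sum_comp Fin.revPerm fun i => (-a i) ^ k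
    rw [hreindex]
    rcases Nat.even_or_odd k with heven | hodd
    · simp [heven.neg_pow]
    · simp [hodd.neg_pow, h k hodd hk]
  have hanti : Antitone fun i => -a (Fin.rev i) := fun i j hij =>
    neg_le_neg (ha (Fin.rev_le_rev.2 hij))
  have heq := eq_of_antitone_of_multiset_map_eq ha hanti (multiset_map_eq_of_sum_pow_eq hpow)
  exact (neg_eq_iff_eq_neg.2 (congrFun heq i)).symm

end NewtonIdentities

section SpectralCone

variable {n : ℕ} {a : Fin n → ℝ}

/-- The spectrum rescaled to Euclidean length one. -/
def unitSpectrum (a : Fin n → ℝ) : Fin n → ℝ := (√(∑ i, a i ^ 2))⁻¹ • a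

theorem unitSpectrum_eq_self (ha : ∑ i, a i ^ 2 = 1) : unitSpectrum a = a := by
  simp [unitSpectrum, ha]

variable [NeZero n]

/-- The indices of the first half of `Fin n`, representing `Fin n` up to reversal. -/
def halfIndex (n : ℕ) [NeZero n] (l : Fin ((n - 1) / 2 + 1)) : Fin n :=
  ⟨l, by have := NeZero.pos n; omega⟩

/-- The representative of an index up to reversal. -/
def foldIndex (i : Fin n) : Fin ((n - 1) / 2 + 1) :=
  ⟨min i (n - 1 - i), by omega⟩

theorem foldIndex_halfIndex (l : Fin ((n - 1) / 2 + 1)) : foldIndex (halfIndex n l) = l := by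
  ext
  simp only [foldIndex, halfIndex]
  omega

theorem halfIndex_foldIndex (i : Fin n) :
    halfIndex n (foldIndex i) = i ∨ halfIndex n (foldIndex i) = i.rev := by
  simp only [Fin.ext_iff, halfIndex, foldIndex, Fin.val_rev]
  omega

theorem halfIndex_le_rev (l : Fin ((n - 1) / 2 + 1)) : halfIndex n l ≤ (halfIndex n l).rev := by
  rw [Fin.le_def, Fin.val_rev]
  simp only [halfIndex]
  omega

theorem linearIndependent_pow_iff_injective {K : Type*} [Field K] {m : ℕ} {x : Fin m → K} :
    (LinearIndependent K fun j : Fin m => x ^ (j : ℕ)) ↔ Function.Injective x := by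
  rw [← Matrix.det_vandermonde_ne_zero_iff, ← isUnit_iff_ne_zero, ← Matrix.isUnit_iff_isUnit_det,
    ← Matrix.linearIndependent_cols_iff_isUnit]
  rfl

theorem linearIndependent_even_pow_iff (ha : ∀ i, a i.rev = -a i) :
    (LinearIndependent ℝ fun j : Fin ((n - 1) / 2 + 1) => a ^ (2 * (j : ℕ))) ↔
      Function.Injective fun l => a (halfIndex n l) ^ 2 := by
  have hfold : Function.Surjective (foldIndex : Fin n → _) := fun l => ⟨_, foldIndex_halfIndex l⟩
  have hsq : ∀ i, a i ^ 2 = a (halfIndex n (foldIndex i)) ^ 2 := by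
    intro i
    rcases halfIndex_foldIndex i with h | h
    · rw [h]
    · rw [h, ha, neg_sq]
  have hpow : (fun j : Fin ((n - 1) / 2 + 1) => a ^ (2 * (j : ℕ))) =
      LinearMap.funLeft ℝ ℝ foldIndex ∘
        fun j : Fin ((n - 1) / 2 + 1) => (fun l => a (halfIndex n l) ^ 2) ^ (j : ℕ) := by
    ext j i
    simp [LinearMap.funLeft_apply, pow_mul, hsq i]
  rw [← linearIndependent_pow_iff_injective, hpow]
  exact LinearMap.linearIndependent_iff (LinearMap.funLeft ℝ ℝ foldIndex)
    (LinearMap.ker_eq_bot.2 (LinearMap.funLeft_injective_of_surjective ℝ ℝ _ hfold))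

variable (n) in
/-- The spectra, in decreasing order, of the positive multiples of the elements of `B n F`: they are
symmetric about `0`, and as many eigenvalues as this symmetry permits are distinct. -/
def spectralCone : Set (Fin n → ℝ) :=
  {a | (∀ i, a i.rev = -a i) ∧ Antitone a ∧ (StrictAnti fun l => a (halfIndex n l)) ∧ 0 < a 0}

theorem convex_spectralCone : Convex ℝ (spectralCone n) := by
  rintro a ⟨arev, aanti, astrict, apos⟩ b ⟨brev, banti, bstrict, bpos⟩ s t hs ht hst
  have comb_lt : ∀ {x y x' y' : ℝ}, x < x' → y < y' → s * x + t * y < s * x' + t * y' := by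
    intro x y x' y' hx hy
    rcases hs.eq_or_lt with rfl | hs'
    · obtain rfl : t = 1 := by linarith
      simpa using hy
    · exact add_lt_add_of_lt_of_le (mul_lt_mul_of_pos_left hx hs')
        (mul_le_mul_of_nonneg_left hy.le ht)
  refine ⟨fun i => ?_, (aanti.const_mul hs).add (banti.const_mul ht),
    fun l m hlm => comb_lt (astrict hlm) (bstrict hlm), ?_⟩
  · simp only [Pi.add_apply, Pi.smul_apply, smul_eq_mul, arev, brev]
    ring
  · simpa using comb_lt apos bpos

theorem nonempty_spectralCone (hn : 2 ≤ n) : (spectralCone n).Nonempty := by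
  have hanti : StrictAnti fun i : Fin n => (n - 1 - 2 * (i : ℕ) : ℝ) := by
    intro i j hij
    have hij' : ((i : ℕ) : ℝ) < (j : ℕ) := by exact_mod_cast hij
    dsimp only
    linarith
  refine ⟨fun i => n - 1 - 2 * (i : ℕ), fun i => ?_, hanti.antitone, fun l m hlm => hanti hlm, ?_⟩
  · dsimp only
    rw [Fin.val_rev, Nat.cast_sub i.2]
    push_cast
    ring
  · have hn' : (2 : ℝ) ≤ n := by exact_mod_cast hn
    simp only [Fin.val_zero, Nat.cast_zero]
    linarith

theorem mem_spectralCone_iff (ha : Antitone a) (hrev : ∀ i, a i.rev = -a i) (hne : a ≠ 0) :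
    a ∈ spectralCone n ↔ Function.Injective fun l => a (halfIndex n l) ^ 2 := by
  have hnonneg : ∀ l, 0 ≤ a (halfIndex n l) := by
    intro l
    have hle := ha (halfIndex_le_rev l)
    rw [hrev] at hle
    linarith
  have hpos : 0 < a 0 := by
    refine lt_of_le_of_ne (hnonneg 0) fun hzero => hne (funext fun i => ?_)
    have hle : a i ≤ a 0 := ha (Fin.zero_le i)
    have hrev_le : a i.rev ≤ a 0 := ha (Fin.zero_le _)
    rw [hrev] at hrev_le
    simp only [Pi.zero_apply]
    linarith [show a 0 = 0 from hzero.symm]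
  refine ⟨fun h l m hlm => h.2.2.1.injective ?_, fun h => ⟨hrev, ha, fun l m hlm => ?_, hpos⟩⟩
  · exact (pow_left_inj₀ (hnonneg l) (hnonneg m) two_ne_zero).1 hlm
  · refine lt_of_le_of_ne (ha hlm.le) fun heq => hlm.ne' (h ?_)
    simp only [heq]

theorem smul_mem_spectralCone (ha : a ∈ spectralCone n) {r : ℝ} (hr : 0 < r) :
    r • a ∈ spectralCone n := by
  obtain ⟨hrev, hanti, hstrict, hpos⟩ := ha
  exact ⟨fun i => by simp [hrev], hanti.const_mul hr.le,
    fun l m hlm => mul_lt_mul_of_pos_left (hstrict hlm) hr, mul_pos hr hpos⟩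

theorem sum_eq_zero_of_mem_spectralCone (ha : a ∈ spectralCone n) : ∑ i, a i = 0 := by
  simpa using sum_odd_pow_eq_zero ha.1 odd_one

theorem sum_sq_pos (ha : a ∈ spectralCone n) : 0 < ∑ i, a i ^ 2 :=
  Finset.sum_pos' (fun _ _ => sq_nonneg _) ⟨0, Finset.mem_univ _, pow_pos ha.2.2.2 2⟩

theorem unitSpectrum_mem (ha : a ∈ spectralCone n) : unitSpectrum a ∈ spectralCone n :=
  smul_mem_spectralCone ha (inv_pos.2 (Real.sqrt_pos.2 (sum_sq_pos ha)))

theorem sum_unitSpectrum_sq (ha : a ∈ spectralCone n) : ∑ i, unitSpectrum a i ^ 2 = 1 := by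
  simp only [unitSpectrum, Pi.smul_apply, smul_eq_mul, mul_pow, ← Finset.mul_sum, inv_pow]
  rw [Real.sq_sqrt (sum_sq_pos ha).le, inv_mul_cancel₀ (sum_sq_pos ha).ne']

theorem continuousOn_unitSpectrum :
    ContinuousOn (unitSpectrum : (Fin n → ℝ) → Fin n → ℝ) (spectralCone n) := by
  refine ContinuousOn.smul (ContinuousOn.inv₀ (Continuous.continuousOn (by fun_prop))
    fun a ha => (Real.sqrt_pos.2 (sum_sq_pos ha)).ne') continuousOn_id

/- Antisymmetry of `a` turns the sum into one half of `∑ i, a i * (d i - d i.rev)`, all of whose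
terms are nonnegative; the first one forces `d 0 = d (rev 0)`, hence `d` to be constant. -/
theorem eq_zero_of_sum_mul_eq_zero {d : Fin n → ℝ} (ha : a ∈ spectralCone n) (hd : Antitone d)
    (hsum : ∑ i, d i = 0) (h : ∑ i, a i * d i = 0) : d = 0 := by
  obtain ⟨hrev, hanti, -, hpos⟩ := ha
  have hmul_rev : ∑ i, a i * d (Fin.rev i) = 0 := by
    rw [← neg_eq_zero, ← h, ← Finset.sum_neg_distrib, ← Equiv.sum_comp Fin.revPerm]
    simp [hrev]
  have hdiff : ∑ i, a i * (d i - d (Fin.rev i)) = 0 := by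
    simp only [mul_sub, Finset.sum_sub_distrib, h, hmul_rev, sub_zero]
  have hnonneg : ∀ i ∈ Finset.univ, 0 ≤ a i * (d i - d (Fin.rev i)) := by
    intro i _
    rcases le_total i i.rev with hi | hi <;> have hle := hanti hi <;> rw [hrev] at hle
    · exact mul_nonneg (by linarith) (sub_nonneg.2 (hd hi))
    · exact mul_nonneg_of_nonpos_of_nonpos (by linarith) (sub_nonpos.2 (hd hi))
  have hends : d 0 = d (Fin.rev 0) := sub_eq_zero.1 ((mul_eq_zero.1
    ((Finset.sum_eq_zero_iff_of_nonneg hnonneg).1 hdiff 0 (Finset.mem_univ _))).resolve_left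
      hpos.ne')
  have hconst : ∀ i, d i = d 0 := fun i =>
    le_antisymm (hd (Fin.zero_le i)) (hends ▸ hd (Fin.le_rev_iff.2 (Fin.zero_le _)))
  simp only [hconst, Finset.sum_const, Finset.card_univ, Fintype.card_fin, nsmul_eq_mul] at hsum
  exact funext fun i => (hconst i).trans ((mul_eq_zero.1 hsum).resolve_left (NeZero.ne _))

end SpectralCone

section PowerSums

variable {q : ℕ}

/-- The power sums `p₁, …, p_q` of `q` variables. -/
def powerSums (m : Fin q → ℝ) : Fin q → ℝ := fun k => ∑ l, m l ^ ((k : ℕ) + 1)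

theorem contDiff_powerSums : ContDiff ℝ ∞ (powerSums : (Fin q → ℝ) → Fin q → ℝ) :=
  contDiff_pi.2 fun _ => ContDiff.sum fun l _ => (contDiff_apply ℝ ℝ l).pow _

/-- The derivative of `powerSums`: a Vandermonde matrix, up to the scaling of its rows. -/
def powerSumsDeriv (m : Fin q → ℝ) : (Fin q → ℝ) →L[ℝ] Fin q → ℝ :=
  ContinuousLinearMap.pi fun k =>
    ∑ l, (((k : ℕ) + 1 : ℝ) * m l ^ (k : ℕ)) • ContinuousLinearMap.proj l

theorem powerSumsDeriv_apply (m h : Fin q → ℝ) (k : Fin q) :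
    powerSumsDeriv m h k = ((k : ℕ) + 1 : ℝ) * ∑ l, h l * m l ^ (k : ℕ) := by
  simp only [powerSumsDeriv, ContinuousLinearMap.coe_pi', _root_.sum_apply, _root_.smul_apply,
    ContinuousLinearMap.proj_apply, smul_eq_mul, Finset.mul_sum]
  exact Finset.sum_congr rfl fun l _ => by ring

theorem hasFDerivAt_powerSums (m : Fin q → ℝ) : HasFDerivAt powerSums (powerSumsDeriv m) m := by
  refine hasFDerivAt_pi.2 fun k => HasFDerivAt.fun_sum fun l _ => ?_
  simpa using (hasFDerivAt_apply (𝕜 := ℝ) l m).pow ((k : ℕ) + 1)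

theorem powerSumsDeriv_injective {m : Fin q → ℝ} (hm : Function.Injective m) :
    Function.Injective (powerSumsDeriv m) := by
  rw [injective_iff_map_eq_zero]
  intro h hh
  refine Matrix.eq_zero_of_forall_pow_sum_mul_pow_eq_zero hm fun k => ?_
  have hk : powerSumsDeriv m h k = 0 := congrFun hh k
  rw [powerSumsDeriv_apply] at hk
  exact (mul_eq_zero.1 hk).resolve_left (by positivity)

/-- The derivative of `powerSums` at distinct points, as an equivalence. -/
def powerSumsDerivEquiv {m : Fin q → ℝ} (hm : Function.Injective m) :
    (Fin q → ℝ) ≃L[ℝ] Fin q → ℝ :=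
  (LinearEquiv.ofInjectiveEndo (powerSumsDeriv m : (Fin q → ℝ) →ₗ[ℝ] Fin q → ℝ)
    (powerSumsDeriv_injective hm)).toContinuousLinearEquiv

theorem coe_powerSumsDerivEquiv {m : Fin q → ℝ} (hm : Function.Injective m) :
    (powerSumsDerivEquiv hm : (Fin q → ℝ) →L[ℝ] Fin q → ℝ) = powerSumsDeriv m :=
  rfl

/-- Inverting a Vandermonde matrix amounts to Lagrange interpolation. -/
theorem sum_symm_powerSumsDeriv_mul_pow {m : Fin q → ℝ} {L : (Fin q → ℝ) ≃L[ℝ] Fin q → ℝ}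
    (hL : (L : (Fin q → ℝ) →L[ℝ] Fin q → ℝ) = powerSumsDeriv m) (l j : Fin q) :
    ∑ k : Fin q, ((k : ℕ) + 1 : ℝ) * L.symm (Pi.single k 1) l * m j ^ (k : ℕ) =
      if l = j then 1 else 0 := by
  have hsingle : L (Pi.single j 1) =
      ∑ k : Fin q, (((k : ℕ) + 1 : ℝ) * m j ^ (k : ℕ)) • Pi.single k (1 : ℝ) := by
    rw [← ContinuousLinearEquiv.coe_coe, hL]
    ext k
    rw [powerSumsDeriv_apply, Finset.sum_apply]
    simp [Pi.single_apply]
  have hsymm := congrFun (L.symm_apply_apply (Pi.single j 1)) l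
  rw [hsingle, map_sum, Finset.sum_apply, Pi.single_apply] at hsymm
  rw [← hsymm]
  refine Finset.sum_congr rfl fun k _ => ?_
  rw [map_smul, Pi.smul_apply, smul_eq_mul]
  ring

theorem exists_smooth_lagrange {μ : Fin q → ℝ} (hμ : Function.Injective μ) :
    ∃ (T : Set (Fin q → ℝ)) (m : (Fin q → ℝ) → Fin q → ℝ)
      (C : Fin q → Fin q → (Fin q → ℝ) → ℝ), IsOpen T ∧ powerSums μ ∈ T ∧
      (∀ l k, ContDiffOn ℝ ∞ (C l k) T) ∧ ∀ z ∈ T, powerSums (m z) = z ∧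
        ∀ l j, ∑ k, C l k z * m z j ^ (k : ℕ) = if l = j then 1 else 0 := by
  obtain ⟨e, he, hμe, -, hsymm, hder⟩ := exists_smooth_local_inverse contDiff_powerSums
    (powerSumsDerivEquiv hμ) (coe_powerSumsDerivEquiv hμ ▸ hasFDerivAt_powerSums μ) isOpen_univ
    (Set.mem_univ _)
  refine ⟨e.target, e.symm, fun l k z => ((k : ℕ) + 1) * fderiv ℝ e.symm z (Pi.single k 1) l,
    e.open_target, he ▸ e.map_source hμe, fun l k => ?_, fun z hz => ⟨?_, fun l j => ?_⟩⟩
  · have hfderiv := (hsymm.fderiv_of_isOpen (m := ∞) e.open_target (by simp)).clm_apply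
      (contDiffOn_const (c := Pi.single k (1 : ℝ)))
    exact contDiffOn_const.mul (contDiffOn_pi.1 hfderiv l)
  · rw [← he]
    exact e.right_inv hz
  · obtain ⟨L, hL⟩ := hder _ (e.map_target hz)
    simp only [(e.hasFDerivAt_symm hz (he ▸ hL)).fderiv]
    exact sum_symm_powerSumsDeriv_mul_pow (hL.unique (hasFDerivAt_powerSums _)) l j

theorem exists_eq_of_powerSums_eq {m m' : Fin q → ℝ} (h : powerSums m = powerSums m')
    (l : Fin q) : ∃ j, m l = m' j := by
  have hmap : Finset.univ.val.map m = Finset.univ.val.map m' := by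
    refine multiset_map_eq_of_sum_pow_eq fun k hk hkq => ?_
    obtain ⟨k, rfl⟩ := Nat.exists_eq_add_of_le' hk
    exact congrFun h ⟨k, by simpa using hkq⟩
  have hmem : m l ∈ Finset.univ.val.map m' :=
    hmap ▸ Multiset.mem_map_of_mem m (Finset.mem_univ l)
  obtain ⟨j, -, hj⟩ := Multiset.mem_map.1 hmem
  exact ⟨j, hj.symm⟩

variable {n : ℕ} [NeZero n]

theorem sum_eq_two_mul_sum_halfIndex {G : Fin n → ℝ}
    (hG : ∀ i, G (Fin.rev i) = G i) (hmid : ∀ i, Fin.rev i = i → G i = 0) :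
    ∑ i, G i = 2 * ∑ l, G (halfIndex n l) := by
  let lower : Fin n → ℝ := fun i => if (i : ℕ) ≤ (n - 1) / 2 then G i else 0
  have hfold : ∀ i, G i = lower i + lower (Fin.rev i) := by
    intro i
    have hrev : (Fin.rev i : ℕ) = n - (i + 1) := Fin.val_rev i
    by_cases hi : Fin.rev i = i
    · simp [lower, hi, hmid i hi]
    · have hne : (Fin.rev i : ℕ) ≠ i := fun h => hi (Fin.ext h)
      have hor : (i : ℕ) ≤ (n - 1) / 2 ↔ ¬(Fin.rev i : ℕ) ≤ (n - 1) / 2 := by omega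
      simp only [lower, hG, hor]
      split_ifs <;> simp
  have hrev : ∑ i, lower (Fin.rev i) = ∑ i, lower i := Equiv.sum_comp Fin.revPerm lower
  have hhalf : ∑ l, G (halfIndex n l) = ∑ i, lower i := by
    refine Fintype.sum_of_injective (halfIndex n)
      (Function.LeftInverse.injective foldIndex_halfIndex) _ _ (fun i hi => ?_) fun l => ?_
    · exact if_neg fun h => hi ⟨⟨i, by omega⟩, rfl⟩
    · exact (if_pos (Nat.le_of_lt_succ l.2)).symm
  rw [Finset.sum_congr rfl fun i _ => hfold i, Finset.sum_add_distrib, hrev, hhalf, two_mul]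

theorem powerSums_halfIndex {b : Fin n → ℝ} (hb : ∀ i, b i.rev = -b i)
    (k : Fin ((n - 1) / 2 + 1)) :
    powerSums (fun l => b (halfIndex n l) ^ 2) k = (∑ i, b i ^ (2 * ((k : ℕ) + 1))) / 2 := by
  rw [sum_eq_two_mul_sum_halfIndex (G := fun i => b i ^ (2 * ((k : ℕ) + 1)))]
  · simp only [powerSums, ← pow_mul]
    ring
  · intro i
    simp only [hb, (even_two_mul _).neg_pow]
  · intro i hi
    have hzero : b i = 0 := self_eq_neg.1 (by rw [← hb i, hi])
    simp [hzero]

end PowerSums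

open Filter Topology Matrix

/-- A class satisfied by `ℝ`, `ℂ`, `ℍ`: a real algebra with conjugation, whose inner product is
`⟪a, b⟫ = Re (a * star b)`, where the real part `Re a = ⟪1, a⟫` is tracial and self-adjoint elements
are real. -/
class HermitianAlgebra (F : Type*) [NormedRing F] [StarRing F] [InnerProductSpace ℝ F]
    [StarModule ℝ F] : Prop extends IsScalarTower ℝ F F, SMulCommClass ℝ F F where
  inner_eq (a b : F) : inner ℝ a b = inner ℝ 1 (a * star b)
  re_mul_comm (a b : F) : inner ℝ 1 (a * b) = inner ℝ 1 (b * a)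
  eq_re_smul_one (a : F) : star a = a → a = (inner ℝ 1 a : ℝ) • (1 : F)
  norm_one : ‖(1 : F)‖ = 1

instance : HermitianAlgebra ℝ where
  inner_eq a b := by simp [mul_comm]
  re_mul_comm a b := by simp [mul_comm]
  eq_re_smul_one a _ := by simp
  norm_one := by simp

instance : HermitianAlgebra ℂ where
  inner_eq a b := by simp [Complex.inner, mul_comm]
  re_mul_comm a b := by simp [mul_comm]
  eq_re_smul_one a ha := by
    have him : a.im = 0 := Complex.conj_eq_iff_im.1 ha
    apply Complex.ext <;> simp [Complex.inner, him]
  norm_one := by simp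

instance : HermitianAlgebra ℍ[ℝ] where
  inner_eq a b := by
    simp only [Quaternion.inner_def, one_mul, star_mul, star_star, Quaternion.re_mul,
      Quaternion.re_star, Quaternion.imI_star, Quaternion.imJ_star, Quaternion.imK_star]
    ring
  re_mul_comm a b := by
    simp only [Quaternion.inner_def, one_mul, Quaternion.re_star, Quaternion.re_mul]
    ring
  eq_re_smul_one a ha := by
    rw [Quaternion.star_eq_self] at ha
    simp only [Quaternion.inner_def, one_mul, Quaternion.re_star]
    nth_rewrite 1 [ha]
    ext <;> simp
  norm_one := by simp

variable {n : ℕ} {F : Type*} [NormedRing F] [InnerProductSpace ℝ F]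

section FrobeniusNorm

theorem frobenius_norm_sq (A : Matrix (Fin n) (Fin n) F) : ‖A‖ ^ 2 = ∑ i, ∑ j, ‖A i j‖ ^ 2 := by
  rw [← real_inner_self_eq_norm_sq]
  exact Finset.sum_congr rfl fun i _ => Finset.sum_congr rfl fun j _ =>
    real_inner_self_eq_norm_sq _

theorem frobenius_norm_mul_le (A B : Matrix (Fin n) (Fin n) F) : ‖A * B‖ ≤ ‖A‖ * ‖B‖ := by
  refine abs_le_of_sq_le_sq' ?_ (by positivity) |>.2
  rw [mul_pow, frobenius_norm_sq, frobenius_norm_sq, frobenius_norm_sq, Finset.sum_mul]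
  refine Finset.sum_le_sum fun i _ => ?_
  rw [Finset.sum_comm (f := fun i j => ‖B i j‖ ^ 2), Finset.mul_sum]
  refine Finset.sum_le_sum fun j _ => ?_
  calc ‖(A * B) i j‖ ^ 2 ≤ (∑ k, ‖A i k‖ * ‖B k j‖) ^ 2 := by
        rw [Matrix.mul_apply]
        gcongr
        exact (norm_sum_le _ _).trans (Finset.sum_le_sum fun k _ => norm_mul_le _ _)
    _ ≤ (∑ k, ‖A i k‖ ^ 2) * ∑ k, ‖B k j‖ ^ 2 := Finset.sum_mul_sq_le_sq_mul_sq _ _ _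

/-- Square matrices over `F` as a normed ring for the Frobenius norm. Mathlib's
`Matrix.frobeniusNormedRing` is restricted to `RCLike` fields. -/
@[reducible]
def matrixNormedRing : NormedRing (Matrix (Fin n) (Fin n) F) :=
  { Matrix.frobeniusNormedAddCommGroup, Matrix.instRing with
    norm_mul_le := frobenius_norm_mul_le }

attribute [local instance] matrixNormedRing

/-- Square matrices over `F` as a real normed algebra for the Frobenius norm. -/
@[reducible]
def matrixNormedAlgebra [IsScalarTower ℝ F F] [SMulCommClass ℝ F F] :
    NormedAlgebra ℝ (Matrix (Fin n) (Fin n) F) :=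
  { Algebra.ofModule (fun r A B => Matrix.smul_mul r A B) fun r A B => Matrix.mul_smul A r B with
    norm_smul_le := fun r A => norm_smul_le r A }

/-- The topology of the Frobenius norm, which takes precedence over the product topology on
matrices. -/
@[reducible]
def matrixTopology : TopologicalSpace (Matrix (Fin n) (Fin n) F) :=
  Matrix.frobeniusNormedAddCommGroup.toPseudoMetricSpace.toUniformSpace.toTopologicalSpace

end FrobeniusNorm

attribute [local instance] matrixNormedRing matrixNormedAlgebra matrixTopology

theorem matrixT2Space : T2Space (Matrix (Fin n) (Fin n) F) :=
  @TopologicalSpace.t2Space_of_metrizableSpace _ _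
    (@EMetricSpace.metrizableSpace _ (@MetricSpace.toEMetricSpace _ inferInstance))

attribute [local instance] matrixT2Space

variable (n F) in
/-- The real part of the trace. -/
def reTrace : Matrix (Fin n) (Fin n) F →ₗ[ℝ] ℝ :=
  (innerₛₗ ℝ (1 : F)) ∘ₗ Matrix.traceLinearMap (Fin n) ℝ F

theorem reTrace_apply (A : Matrix (Fin n) (Fin n) F) :
    reTrace n F A = ∑ i, inner ℝ (1 : F) (A i i) := by
  simp [reTrace, Matrix.trace, inner_sum]

theorem reTrace_mul_single (C : Matrix (Fin n) (Fin n) F) (i j : Fin n) (u : F) :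
    reTrace n F (C * Matrix.single i j u) = inner ℝ 1 (C j i * u) := by
  rw [reTrace_apply, Finset.sum_eq_single j]
  · simp
  · intro k _ hk
    simp [hk]
  · simp

section RotationGenerator

variable {R : Type*} [Ring R] [StarRing R]

/-- The skew-Hermitian matrices `Z` with eigenvalues among `0, ±i`, so that `exp (θ * Z)` is
polynomial in `Z` with trigonometric coefficients. -/
structure IsRotationGenerator (Z : Matrix (Fin n) (Fin n) R) : Prop where
  conjTranspose_eq : Zᴴ = -Z
  cube_eq : Z * Z * Z = -Z

/-- The generator of the rotations in the plane of the `i`-th and `j`-th coordinates, with phase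
`u`. -/
def planeGenerator (i j : Fin n) (u : R) : Matrix (Fin n) (Fin n) R :=
  Matrix.single i j u - Matrix.single j i (star u)

variable {i j : Fin n} {u : R}

theorem planeGenerator_sq (hij : i ≠ j) (hu : u ∈ unitary R) :
    planeGenerator i j u * planeGenerator i j u =
      -(Matrix.single i i 1 + Matrix.single j j 1) := by
  simp only [planeGenerator, sub_mul, mul_sub, single_mul_single_same,
    single_mul_single_of_ne _ _ _ _ hij, single_mul_single_of_ne _ _ _ _ hij.symm,
    Unitary.mul_star_self_of_mem hu, Unitary.star_mul_self_of_mem hu]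
  abel

theorem isRotationGenerator_planeGenerator (hij : i ≠ j) (hu : u ∈ unitary R) :
    IsRotationGenerator (planeGenerator i j u) where
  conjTranspose_eq := by simp [planeGenerator, Matrix.conjTranspose_single]
  cube_eq := by
    rw [planeGenerator_sq hij hu]
    simp [planeGenerator, add_mul, mul_sub, hij, hij.symm]
    abel

end RotationGenerator

section Rotation

/-- Rodrigues' formula for the rotation `exp (θ * Z)`, for `Z` skew-Hermitian with `Z ^ 3 = -Z`. -/
def rotation (Z : Matrix (Fin n) (Fin n) F) (θ : ℝ) : Matrix (Fin n) (Fin n) F :=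
  1 + Real.sin θ • Z + (1 - Real.cos θ) • (Z * Z)

theorem rotation_zero (Z : Matrix (Fin n) (Fin n) F) : rotation Z 0 = 1 := by
  simp [rotation]

theorem continuous_rotation (Z : Matrix (Fin n) (Fin n) F) : Continuous (rotation Z) := by
  unfold rotation
  fun_prop

theorem hasDerivAt_rotation (Z : Matrix (Fin n) (Fin n) F) : HasDerivAt (rotation Z) Z 0 := by
  have hsin := (Real.hasDerivAt_sin 0).smul_const Z
  have hcos := ((Real.hasDerivAt_cos 0).const_sub 1).smul_const (Z * Z)
  have hsum := ((hasDerivAt_const (0 : ℝ) (1 : Matrix (Fin n) (Fin n) F)).fun_add hsin).fun_add hcos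
  simp only [Real.cos_zero, Real.sin_zero, one_smul, neg_zero, zero_smul, zero_add, add_zero]
    at hsum
  exact hsum

theorem quarterRotation_apply_eq_zero [StarRing F] {i j : Fin n} (hij : i ≠ j)
    {k l : Fin n} (hl : l ≠ Equiv.swap i j k) :
    rotation (planeGenerator i j (1 : F)) (Real.pi / 2) k l = 0 := by
  rw [rotation, planeGenerator_sq hij (one_mem _)]
  simp only [planeGenerator, Real.sin_pi_div_two, Real.cos_pi_div_two, star_one, one_smul, sub_zero,
    Matrix.add_apply, Matrix.sub_apply, Matrix.neg_apply, Matrix.single_apply, Matrix.one_apply]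
  rcases eq_or_ne k i with rfl | hki
  · rw [Equiv.swap_apply_left] at hl
    simp [hij.symm, hl.symm]
  rcases eq_or_ne k j with rfl | hkj
  · rw [Equiv.swap_apply_right] at hl
    simp [hij, hl.symm]
  · rw [Equiv.swap_apply_of_ne_of_ne hki hkj] at hl
    simp [hki.symm, hkj.symm, hl.symm]

end Rotation

variable [StarRing F] [StarModule ℝ F] [HermitianAlgebra F]

theorem re_star (a : F) : inner ℝ (1 : F) (star a) = inner ℝ 1 a := by
  rw [← one_mul (star a), ← HermitianAlgebra.inner_eq]

theorem mul_star_self (a : F) : a * star a = (‖a‖ ^ 2) • (1 : F) := by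
  rw [← real_inner_self_eq_norm_sq, HermitianAlgebra.inner_eq]
  exact HermitianAlgebra.eq_re_smul_one _ (by simp)

theorem norm_star_eq (a : F) : ‖star a‖ = ‖a‖ := by
  have hsq : ‖star a‖ ^ 2 = ‖a‖ ^ 2 := by
    rw [← real_inner_self_eq_norm_sq, ← real_inner_self_eq_norm_sq, HermitianAlgebra.inner_eq,
      HermitianAlgebra.inner_eq a, star_star, HermitianAlgebra.re_mul_comm]
  exact (pow_left_inj₀ (norm_nonneg _) (norm_nonneg _) two_ne_zero).1 hsq

theorem normedStarGroup : NormedStarGroup F :=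
  ⟨fun a => (norm_star_eq a).le⟩

attribute [local instance] normedStarGroup

theorem re_one : inner ℝ (1 : F) 1 = 1 := by
  rw [real_inner_self_eq_norm_sq, HermitianAlgebra.norm_one, one_pow]

theorem reTrace_mul_comm (A B : Matrix (Fin n) (Fin n) F) :
    reTrace n F (A * B) = reTrace n F (B * A) := by
  simp only [reTrace_apply, Matrix.mul_apply, inner_sum]
  rw [Finset.sum_comm]
  simp only [HermitianAlgebra.re_mul_comm]

theorem inner_eq_reTrace (A B : Matrix (Fin n) (Fin n) F) :
    inner ℝ A B = reTrace n F (A * Bᴴ) := by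
  simp only [reTrace_apply, Matrix.mul_apply, inner_sum, Matrix.conjTranspose_apply,
    ← HermitianAlgebra.inner_eq]
  rfl

section Diagonal

variable (n F) in
/-- The embedding of `ℝⁿ` as the real diagonal matrices. -/
def realDiagonal : (Fin n → ℝ) →ₐ[ℝ] Matrix (Fin n) (Fin n) F :=
  AlgHom.ofLinearMap
    { toFun := fun a => Matrix.diagonal fun i => a i • (1 : F)
      map_add' := fun a b => by simp [add_smul, Matrix.diagonal_add]
      map_smul' := fun r a => by simp [mul_smul, ← Matrix.diagonal_smul, Pi.smul_def] }
    (by simp)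
    fun a b => by simp [Matrix.diagonal_mul_diagonal, mul_smul, smul_comm (a _) (b _)]

theorem realDiagonal_eq_diagonal (a : Fin n → ℝ) :
    realDiagonal n F a = Matrix.diagonal fun i => a i • (1 : F) :=
  rfl

theorem realDiagonal_conjTranspose (a : Fin n → ℝ) :
    (realDiagonal n F a)ᴴ = realDiagonal n F a := by
  simp [realDiagonal_eq_diagonal, Matrix.diagonal_conjTranspose]

theorem reTrace_realDiagonal (a : Fin n → ℝ) : reTrace n F (realDiagonal n F a) = ∑ i, a i := by
  simp [reTrace_apply, realDiagonal_eq_diagonal, inner_smul_right, HermitianAlgebra.norm_one]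

theorem realDiagonal_injective : Function.Injective (realDiagonal n F) := fun a b hab => by
  ext i
  have hre := congrArg (fun A : Matrix (Fin n) (Fin n) F => inner ℝ (1 : F) (A i i)) hab
  simpa [realDiagonal_eq_diagonal, inner_smul_right, HermitianAlgebra.norm_one] using hre

end Diagonal

section Unitary

/-- The Hermitian matrix `U * diag(a) * Uᴴ` with eigenbasis `U` and spectrum `a`, as an algebra
homomorphism in `a`. -/
def unitaryDiagonal (U : unitary (Matrix (Fin n) (Fin n) F)) :
    (Fin n → ℝ) →ₐ[ℝ] Matrix (Fin n) (Fin n) F :=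
  (Unitary.conjStarAlgAut ℝ _ U : _ →ₐ[ℝ] _).comp (realDiagonal n F)

variable (U : unitary (Matrix (Fin n) (Fin n) F))

theorem unitaryDiagonal_apply (a : Fin n → ℝ) :
    unitaryDiagonal U a = U * realDiagonal n F a * (U : Matrix (Fin n) (Fin n) F)ᴴ :=
  rfl

theorem unitaryDiagonal_conjTranspose (a : Fin n → ℝ) :
    (unitaryDiagonal U a)ᴴ = unitaryDiagonal U a := by
  simp [unitaryDiagonal_apply, realDiagonal_conjTranspose, Matrix.mul_assoc]

theorem unitaryDiagonal_injective : Function.Injective (unitaryDiagonal U) :=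
  (Unitary.conjStarAlgAut ℝ _ U).injective.comp realDiagonal_injective

theorem reTrace_unitary_conj (A : Matrix (Fin n) (Fin n) F) :
    reTrace n F (U * A * (U : Matrix (Fin n) (Fin n) F)ᴴ) = reTrace n F A := by
  rw [reTrace_mul_comm, ← Matrix.mul_assoc, ← star_eq_conjTranspose,
    Unitary.coe_star_mul_self, Matrix.one_mul]

theorem reTrace_unitaryDiagonal (a : Fin n → ℝ) : reTrace n F (unitaryDiagonal U a) = ∑ i, a i := by
  rw [unitaryDiagonal_apply, reTrace_unitary_conj, reTrace_realDiagonal]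

theorem inner_unitaryDiagonal (a b : Fin n → ℝ) :
    inner ℝ (unitaryDiagonal U a) (unitaryDiagonal U b) = ∑ i, a i * b i := by
  rw [inner_eq_reTrace, unitaryDiagonal_conjTranspose, ← map_mul, reTrace_unitaryDiagonal]
  rfl

theorem norm_unitary_sq : ‖(U : Matrix (Fin n) (Fin n) F)‖ ^ 2 = n := by
  rw [← real_inner_self_eq_norm_sq, inner_eq_reTrace, ← star_eq_conjTranspose,
    Unitary.mul_star_self_of_mem U.2, ← map_one (realDiagonal n F), reTrace_realDiagonal]
  simp

end Unitary

section UnitaryRotation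

namespace IsRotationGenerator

variable {Z : Matrix (Fin n) (Fin n) F}

omit [HermitianAlgebra F] in
theorem conjTranspose_rotation (hZ : IsRotationGenerator Z) (θ : ℝ) :
    (rotation Z θ)ᴴ = rotation Z (-θ) := by
  simp [rotation, hZ.conjTranspose_eq, Matrix.conjTranspose_smul]

theorem rotation_mul_rotation_neg (hZ : IsRotationGenerator Z) (θ : ℝ) :
    rotation Z θ * rotation Z (-θ) = 1 := by
  have hcube : Z * (Z * Z) = -Z := by rw [← Matrix.mul_assoc, hZ.cube_eq]
  have hfourth : Z * Z * (Z * Z) = -(Z * Z) := by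
    rw [← Matrix.mul_assoc, hZ.cube_eq, Matrix.neg_mul]
  simp only [rotation, Real.sin_neg, Real.cos_neg, mul_add, add_mul, mul_one, one_mul,
    smul_mul_assoc, mul_smul_comm, hZ.cube_eq, hcube, hfourth]
  match_scalars <;> first | ring1 | linear_combination -Real.sin_sq_add_cos_sq θ

theorem rotation_mem_unitary (hZ : IsRotationGenerator Z) (θ : ℝ) :
    rotation Z θ ∈ unitary (Matrix (Fin n) (Fin n) F) := by
  rw [Unitary.mem_iff, star_eq_conjTranspose, hZ.conjTranspose_rotation]
  exact ⟨by simpa using hZ.rotation_mul_rotation_neg (-θ), hZ.rotation_mul_rotation_neg θ⟩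

theorem rotation_mem_connectedComponentOfOne (hZ : IsRotationGenerator Z) (θ : ℝ) :
    ⟨rotation Z θ, hZ.rotation_mem_unitary θ⟩ ∈
      Subgroup.connectedComponentOfOne (unitary (Matrix (Fin n) (Fin n) F)) := by
  have hpath : Continuous fun t => (⟨rotation Z t, hZ.rotation_mem_unitary t⟩ :
      unitary (Matrix (Fin n) (Fin n) F)) := (continuous_rotation Z).subtype_mk _
  exact (isPreconnected_range hpath).subset_connectedComponent
    ⟨0, Subtype.ext (rotation_zero Z)⟩ ⟨θ, rfl⟩

end IsRotationGenerator

theorem compactSpace_unitary [FiniteDimensional ℝ F] :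
    CompactSpace (unitary (Matrix (Fin n) (Fin n) F)) := by
  have : ProperSpace (Matrix (Fin n) (Fin n) F) := FiniteDimensional.proper_real _
  refine isCompact_iff_compactSpace.1 (Metric.isCompact_of_isClosed_isBounded isClosed_unitary ?_)
  refine (Metric.isBounded_closedBall (x := 0) (r := √n)).subset fun U hU => ?_
  rw [mem_closedBall_zero_iff]
  exact Real.le_sqrt_of_sq_le (norm_unitary_sq ⟨U, hU⟩).le

theorem quarterRotation_mul_realDiagonal {i j : Fin n} (hij : i ≠ j) (a : Fin n → ℝ) :
    rotation (planeGenerator i j (1 : F)) (Real.pi / 2) * realDiagonal n F a =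
      realDiagonal n F (a ∘ Equiv.swap i j) *
        rotation (planeGenerator i j (1 : F)) (Real.pi / 2) := by
  ext k l
  rw [realDiagonal_eq_diagonal, realDiagonal_eq_diagonal, Matrix.mul_diagonal, Matrix.diagonal_mul,
    Function.comp_apply]
  by_cases hl : l = Equiv.swap i j k
  · rw [hl, mul_smul_comm, mul_one, smul_one_mul]
  · rw [quarterRotation_apply_eq_zero hij hl, zero_mul, mul_zero]

end UnitaryRotation

section SpectralTheorem

/-- Among the conjugates of `A` by rotations, `A` itself maximizes `Re tr (diag(d) * A)`. -/
def IsRotationMaximal (d : Fin n → ℝ) (A : Matrix (Fin n) (Fin n) F) : Prop :=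
  ∀ Z : Matrix (Fin n) (Fin n) F, IsRotationGenerator Z → ∀ θ,
    reTrace n F (realDiagonal n F d * (rotation Z θ * A * (rotation Z θ)ᴴ)) ≤
      reTrace n F (realDiagonal n F d * A)

theorem exists_isRotationMaximal_conj [FiniteDimensional ℝ F] (d : Fin n → ℝ)
    (A : Matrix (Fin n) (Fin n) F) :
    ∃ U ∈ Subgroup.connectedComponentOfOne (unitary (Matrix (Fin n) (Fin n) F)),
      IsRotationMaximal d (U.1 * A * U.1ᴴ) := by
  have hcompact := compactSpace_unitary (n := n) (F := F)
  have htrace : Continuous (reTrace n F) := (reTrace n F).continuous_of_finiteDimensional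
  obtain ⟨U, hU, hmax⟩ :=
    (isClosed_connectedComponent (x := (1 : unitary (Matrix (Fin n) (Fin n) F)))).isCompact
      |>.exists_isMaxOn ⟨1, mem_connectedComponent⟩
      (f := fun U : unitary (Matrix (Fin n) (Fin n) F) =>
        reTrace n F (realDiagonal n F d * (U.1 * A * star U.1)))
      (by fun_prop)
  refine ⟨U, hU, fun Z hZ θ => ?_⟩
  have hle := hmax (Subgroup.mul_mem _ (hZ.rotation_mem_connectedComponentOfOne θ) hU)
  simpa [Matrix.mul_assoc, star_eq_conjTranspose] using hle

namespace IsRotationMaximal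

variable {d : Fin n → ℝ} {A : Matrix (Fin n) (Fin n) F}

theorem reTrace_commutator_mul [FiniteDimensional ℝ F] (h : IsRotationMaximal d A)
    {Z : Matrix (Fin n) (Fin n) F} (hZ : IsRotationGenerator Z) :
    reTrace n F ((A * realDiagonal n F d - realDiagonal n F d * A) * Z) = 0 := by
  set D := realDiagonal n F d
  let L : Matrix (Fin n) (Fin n) F →L[ℝ] ℝ := (reTrace n F).toContinuousLinearMap
  have hrot : HasDerivAt (fun θ => rotation Z (-θ)) (-Z) 0 := by
    have hdiff := hasDerivAt_rotation Z
    rw [← neg_zero] at hdiff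
    have hcomp := hdiff.scomp 0 (hasDerivAt_neg (0 : ℝ))
    rw [neg_smul, one_smul] at hcomp
    exact hcomp
  have hderiv := L.hasFDerivAt.comp_hasDerivAt (0 : ℝ)
    ((((hasDerivAt_rotation Z).mul_const A).mul hrot).const_mul D)
  have hmax : IsLocalMax (L ∘ fun θ => D * (rotation Z θ * A * rotation Z (-θ))) 0 :=
    Filter.Eventually.of_forall fun θ => by
      have hle := h Z hZ θ
      rw [hZ.conjTranspose_rotation] at hle
      simpa [rotation_zero, L] using hle
  rw [← hmax.hasDerivAt_eq_zero hderiv]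
  simp only [neg_zero, rotation_zero, L, LinearMap.coe_toContinuousLinearMap', mul_add, mul_one,
    one_mul, map_add, sub_mul, map_sub, mul_neg, map_neg]
  rw [← Matrix.mul_assoc _ Z A, reTrace_mul_comm (D * Z) A, Matrix.mul_assoc A,
    Matrix.mul_assoc _ A Z]
  abel

-- The phase `u` is chosen such that `A j i * u = ‖A j i‖`.
theorem apply_eq_zero [FiniteDimensional ℝ F] (h : IsRotationMaximal d A) (hA : A.IsHermitian)
    {i j : Fin n} (hij : d i ≠ d j) : A j i = 0 := by
  by_contra hne
  have hnorm : ‖A j i‖ ≠ 0 := norm_ne_zero_iff.2 hne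
  set u : F := ‖A j i‖⁻¹ • star (A j i) with hu
  have hu_norm : ‖u‖ = 1 := by
    rw [hu, norm_smul, norm_star_eq, norm_inv, norm_norm, inv_mul_cancel₀ hnorm]
  have hu_unitary : u ∈ unitary F := by
    refine Unitary.mem_iff.2 ⟨?_, by simp [mul_star_self, hu_norm]⟩
    simpa [norm_star_eq, hu_norm] using mul_star_self (star u)
  have hre : inner ℝ (1 : F) (A j i * u) = ‖A j i‖ := by
    rw [hu, mul_smul_comm, mul_star_self, inner_smul_right, inner_smul_right, re_one]
    field_simp
  have hre' : inner ℝ (1 : F) (A i j * star u) = ‖A j i‖ := by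
    rw [← hA.apply, ← star_mul, re_star, HermitianAlgebra.re_mul_comm, hre]
  have hcomm : ∀ k l, (A * realDiagonal n F d - realDiagonal n F d * A) k l =
      (d l - d k) • A k l := fun k l => by
    simp [realDiagonal_eq_diagonal, sub_smul]
  have hzero := h.reTrace_commutator_mul
    (isRotationGenerator_planeGenerator (fun hij' => hij (congrArg d hij')) hu_unitary)
  rw [planeGenerator, mul_sub, map_sub, reTrace_mul_single, reTrace_mul_single, hcomm, hcomm,
    smul_mul_assoc, smul_mul_assoc, inner_smul_right, inner_smul_right, hre, hre'] at hzero
  have hprod : 2 * (d i - d j) * ‖A j i‖ = 0 := by linear_combination hzero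
  simp [sub_eq_zero, hij, hnorm] at hprod

theorem eq_realDiagonal [FiniteDimensional ℝ F] (h : IsRotationMaximal d A) (hA : A.IsHermitian)
    (hd : Function.Injective d) : A = realDiagonal n F fun i => inner ℝ (1 : F) (A i i) := by
  ext i j
  rcases eq_or_ne i j with rfl | hij
  · rw [realDiagonal_eq_diagonal, Matrix.diagonal_apply_eq]
    exact HermitianAlgebra.eq_re_smul_one _ (hA.apply i i)
  · rw [h.apply_eq_zero hA (hd.ne hij.symm), realDiagonal_eq_diagonal,
      Matrix.diagonal_apply_ne _ hij]

-- Otherwise a quarter turn exchanging two diagonal entries would increase `Re tr (diag(d) * A)`.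
theorem antitone {a : Fin n → ℝ} (h : IsRotationMaximal d (realDiagonal n F a))
    (hd : StrictAnti d) : Antitone a := by
  refine antitone_iff_forall_lt.2 fun i j hij => ?_
  have hgen := isRotationGenerator_planeGenerator hij.ne (one_mem (unitary F))
  have hle := h _ hgen (Real.pi / 2)
  rw [quarterRotation_mul_realDiagonal hij.ne, Matrix.mul_assoc, ← star_eq_conjTranspose,
    Unitary.mul_star_self_of_mem (hgen.rotation_mem_unitary _), mul_one, ← map_mul, ← map_mul,
    reTrace_realDiagonal, reTrace_realDiagonal, ← sub_nonneg, ← Finset.sum_sub_distrib,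
    Fintype.sum_eq_add i j hij.ne fun k hk => by
      simp [Equiv.swap_apply_of_ne_of_ne hk.1 hk.2]] at hle
  simp only [Pi.mul_apply, Function.comp_apply, Equiv.swap_apply_left,
    Equiv.swap_apply_right] at hle
  have hprod : 0 ≤ (d i - d j) * (a i - a j) := by linarith
  exact sub_nonneg.1 (nonneg_of_mul_nonneg_right hprod (sub_pos.2 (hd hij)))

end IsRotationMaximal

theorem exists_eq_unitaryDiagonal [FiniteDimensional ℝ F] {A : Matrix (Fin n) (Fin n) F}
    (hA : A.IsHermitian) :
    ∃ U ∈ Subgroup.connectedComponentOfOne (unitary (Matrix (Fin n) (Fin n) F)),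
      ∃ a : Fin n → ℝ, Antitone a ∧ A = unitaryDiagonal U a := by
  have hd : StrictAnti fun i : Fin n => -(i : ℝ) := fun i j hij => by simpa using hij
  obtain ⟨U, hU, hmax⟩ := exists_isRotationMaximal_conj (fun i : Fin n => -(i : ℝ)) A
  have hdiag := hmax.eq_realDiagonal
    (isHermitian_mul_mul_conjTranspose (U : Matrix (Fin n) (Fin n) F) hA) hd.injective
  rw [hdiag] at hmax
  refine ⟨U⁻¹, inv_mem hU, _, hmax.antitone hd, ?_⟩
  have hconj := congrArg (fun e => e A) (map_mul (Unitary.conjStarAlgAut ℝ (Matrix _ _ F)) U⁻¹ U)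
  rw [inv_mul_cancel, map_one] at hconj
  rwa [unitaryDiagonal_apply, ← hdiag]

end SpectralTheorem

/-- A shortcut: without it, unifying the two norms on `E n F` exhausts instance search. -/
local instance innerProductSpaceE : InnerProductSpace ℝ (E n F) := Submodule.innerProductSpace _

section PowerTraces

omit [HermitianAlgebra F] in
theorem conjTranspose_coe (X : E n F) :
    (X : Matrix (Fin n) (Fin n) F)ᴴ = (X : Matrix (Fin n) (Fin n) F) := X.2.1

theorem trace_eq_reTrace_smul_one {A : Matrix (Fin n) (Fin n) F} (hA : A.IsHermitian) :
    Matrix.trace A = reTrace n F A • (1 : F) :=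
  HermitianAlgebra.eq_re_smul_one _ (by rw [← Matrix.trace_conjTranspose, hA])

theorem mem_E_iff {A : Matrix (Fin n) (Fin n) F} :
    A ∈ E n F ↔ A.IsHermitian ∧ reTrace n F A = 0 := by
  refine ⟨fun h => ⟨h.1, ?_⟩, fun h => ⟨h.1, ?_⟩⟩
  · have htrace : Matrix.trace A = 0 := h.2
    simp [reTrace, htrace]
  · rw [trace_eq_reTrace_smul_one h.1, h.2, zero_smul]

theorem unitaryDiagonal_mem_E_iff {U : unitary (Matrix (Fin n) (Fin n) F)} {a : Fin n → ℝ} :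
    unitaryDiagonal U a ∈ E n F ↔ ∑ i, a i = 0 := by
  have hherm : (unitaryDiagonal U a).IsHermitian := unitaryDiagonal_conjTranspose U a
  rw [mem_E_iff, reTrace_unitaryDiagonal, and_iff_right hherm]

omit [HermitianAlgebra F] in
theorem f_eq_reTrace (k : ℕ) (A : E n F) :
    f k A = reTrace n F ((A : Matrix (Fin n) (Fin n) F) ^ k) := rfl

theorem hasFDerivAt_coe_pow (k : ℕ) (A : E n F) :
    HasFDerivAt (fun X : E n F => (X : Matrix (Fin n) (Fin n) F) ^ k)
      (∑ i ∈ Finset.range k, MulOpposite.op ((A : Matrix (Fin n) (Fin n) F) ^ i) •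
        (A : Matrix (Fin n) (Fin n) F) ^ (k.pred - i) • (E n F).subtypeL) A :=
  ((E n F).subtypeL.hasFDerivAt (x := A)).fun_pow' k

theorem contDiff_coe_pow (k : ℕ) :
    ContDiff ℝ ∞ fun X : E n F => (X : Matrix (Fin n) (Fin n) F) ^ k :=
  (E n F).subtypeL.contDiff.pow k

theorem reTrace_sum_pow_mul_mul_pow (k : ℕ) (A X : Matrix (Fin n) (Fin n) F) :
    reTrace n F (∑ i ∈ Finset.range k, A ^ (k.pred - i) * X * A ^ i) =
      k * reTrace n F (A ^ (k - 1) * X) := by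
  have hterm : ∀ i ∈ Finset.range k,
      reTrace n F (A ^ (k.pred - i) * X * A ^ i) = reTrace n F (A ^ (k - 1) * X) := by
    intro i hi
    rw [reTrace_mul_comm, ← Matrix.mul_assoc, ← pow_add, Nat.pred_eq_sub_one,
      Nat.add_sub_cancel' (Nat.le_sub_one_of_lt (Finset.mem_range.1 hi))]
  rw [map_sum, Finset.sum_congr rfl hterm, Finset.sum_const, Finset.card_range, nsmul_eq_mul]

variable [FiniteDimensional ℝ F]

variable (n F) in
/-- The orthogonal projection onto the traceless Hermitian matrices. -/
def projE : Matrix (Fin n) (Fin n) F →L[ℝ] E n F := (E n F).orthogonalProjectionOnto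

omit [HermitianAlgebra F] in
theorem projE_coe (X : E n F) : projE n F (X : Matrix (Fin n) (Fin n) F) = X :=
  (E n F).orthogonalProjectionOnto_mem_subspace_eq_self X

theorem inner_projE (A : Matrix (Fin n) (Fin n) F) (X : E n F) :
    inner ℝ (projE n F A) X = reTrace n F (A * X) := by
  rw [projE, Submodule.inner_orthogonalProjectionOnto_eq_of_mem_right X A, inner_eq_reTrace,
    conjTranspose_coe]

theorem projE_one : projE n F (1 : Matrix (Fin n) (Fin n) F) = 0 :=
  ext_inner_right ℝ fun X => by
    rw [inner_projE, Matrix.one_mul, (mem_E_iff.1 X.2).2, inner_zero_left]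

theorem coe_projE [NeZero n] {A : Matrix (Fin n) (Fin n) F} (hA : A.IsHermitian) :
    (projE n F A : Matrix (Fin n) (Fin n) F) = A - (reTrace n F A / n) • 1 := by
  have hone : reTrace n F (1 : Matrix (Fin n) (Fin n) F) = n := by
    rw [← map_one (realDiagonal n F), reTrace_realDiagonal]
    simp
  have hmem : A - (reTrace n F A / n) • (1 : Matrix (Fin n) (Fin n) F) ∈ E n F := by
    refine mem_E_iff.2 ⟨by simp [Matrix.IsHermitian, hA.eq, Matrix.conjTranspose_smul], ?_⟩
    rw [map_sub, map_smul, hone, smul_eq_mul, div_mul_cancel₀ _ (NeZero.ne _), sub_self]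
  have hproj := congrArg Subtype.val (projE_coe ⟨_, hmem⟩)
  rwa [map_sub, map_smul, projE_one, smul_zero, sub_zero] at hproj

theorem hasFDerivAt_f (k : ℕ) (A : E n F) :
    HasFDerivAt (f k) ((k : ℝ) • innerSL ℝ (projE n F ((A : Matrix (Fin n) (Fin n) F) ^ (k - 1))))
      A := by
  have hcomp := (reTrace n F).toContinuousLinearMap.hasFDerivAt.comp A (hasFDerivAt_coe_pow k A)
  refine HasFDerivAt.congr_fderiv (f := f k) hcomp (ContinuousLinearMap.ext fun X => ?_)
  rw [_root_.smul_apply, innerSL_apply_apply, smul_eq_mul, inner_projE,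
    ← reTrace_sum_pow_mul_mul_pow, ContinuousLinearMap.comp_apply, _root_.sum_apply]
  rfl

theorem contDiff_f (k : ℕ) : ContDiff ℝ ∞ (f k : E n F → ℝ) :=
  (reTrace n F).toContinuousLinearMap.contDiff.comp (contDiff_coe_pow k)

theorem contDiff_Phi : ContDiff ℝ ∞ (Phi : E n F → Fin ((n - 1) / 2) → ℝ) :=
  contDiff_pi.2 fun _ => contDiff_f _

/-- The gradient of `f (2 * j + 3)` at `A`, up to the factor `2 * j + 3`: the traceless part of
`A ^ (2 * j + 2)`. -/
def evenNormal (j : Fin ((n - 1) / 2)) (A : E n F) : E n F :=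
  projE n F ((A : Matrix (Fin n) (Fin n) F) ^ (2 * (j : ℕ) + 2))

theorem fderiv_Phi_apply (A X : E n F) (j : Fin ((n - 1) / 2)) :
    fderiv ℝ Phi A X j = (2 * (j : ℕ) + 3 : ℝ) * inner ℝ (evenNormal j A) X := by
  have hPhi : HasFDerivAt Phi _ A := hasFDerivAt_pi.2 fun j : Fin ((n - 1) / 2) =>
    hasFDerivAt_f (2 * (j : ℕ) + 3) A
  rw [hPhi.fderiv]
  simp [evenNormal]

theorem fderiv_Phi_eq_zero_iff {A X : E n F} :
    fderiv ℝ Phi A X = 0 ↔ ∀ j, inner ℝ (evenNormal j A) X = 0 := by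
  have hpos : ∀ j : ℕ, (2 * j + 3 : ℝ) ≠ 0 := fun j => by positivity
  simp [funext_iff, fderiv_Phi_apply, hpos]

theorem ker_fderiv_Phi (A : E n F) :
    (fderiv ℝ Phi A).ker = (Submodule.span ℝ (Set.range fun j => evenNormal j A))ᗮ := by
  ext X
  rw [mem_orthogonal_span_range_iff]
  exact fderiv_Phi_eq_zero_iff

theorem surjective_fderiv_Phi_iff {A : E n F} :
    Function.Surjective (fderiv ℝ Phi A) ↔ LinearIndependent ℝ fun j => evenNormal j A := by
  let scale := LinearEquiv.piCongrRight fun j : Fin ((n - 1) / 2) =>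
    LinearEquiv.smulOfNeZero ℝ ℝ (2 * (j : ℕ) + 3 : ℝ) (by positivity)
  have hscale : ⇑(fderiv ℝ Phi A) = scale ∘ fun X j => inner ℝ (evenNormal j A) X := by
    ext X j
    simp [scale, fderiv_Phi_apply]
  rw [hscale]
  exact (scale.toEquiv.comp_surjective _).trans (surjective_inner_iff_linearIndependent _)

theorem fderiv_Phi_self (A : E n F) (hA : Phi A = 0) : fderiv ℝ Phi A A = 0 := by
  refine fderiv_Phi_eq_zero_iff.2 fun j => ?_
  rw [evenNormal, inner_projE, ← pow_succ]
  exact congrFun hA j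

end PowerTraces

section LevelSet

variable [FiniteDimensional ℝ F] {A : E n F}

theorem mem_B_iff_linearIndependent : A ∈ B n F ↔
    ‖A‖ = 1 ∧ Phi A = 0 ∧ LinearIndependent ℝ fun j => evenNormal j A := by
  rw [← surjective_fderiv_Phi_iff]
  exact mem_regularSet_iff (contDiff_Phi.differentiable (by simp)) fderiv_Phi_self

variable (n F) in
theorem isRegularLevelSet_B :
    IsRegularLevelSet (B n F) {A | Function.Surjective (fderiv ℝ Phi A)}
      fun A => (‖A‖ ^ 2, Phi A) :=
  isRegularLevelSet_regularSet contDiff_Phi fderiv_Phi_self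

theorem normalSpace_B (hA : A ∈ B n F) : normalSpace (S n F) (B n F) A =
    Submodule.span ℝ (Set.range fun j => evenNormal j A) := by
  rw [← Submodule.orthogonal_orthogonal (Submodule.span ℝ _), ← ker_fderiv_Phi]
  exact normalSpace_regularSet contDiff_Phi fderiv_Phi_self hA

end LevelSet

section EvenPolynomial

variable {R : Type*} [Ring R] [Algebra ℝ R] {q : ℕ}

/-- The value at `x` of the even polynomial with coefficients `C`. -/
def evenPolynomial (C : Fin q → ℝ) (x : R) : R := ∑ k : Fin q, C k • x ^ (2 * (k : ℕ))

theorem map_evenPolynomial {R' : Type*} [Ring R'] [Algebra ℝ R'] (φ : R →ₐ[ℝ] R') (C : Fin q → ℝ)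
    (x : R) : φ (evenPolynomial C x) = evenPolynomial C (φ x) := by
  simp [evenPolynomial]

theorem evenPolynomial_apply {ι : Type*} (C : Fin q → ℝ) (a : ι → ℝ) (i : ι) :
    evenPolynomial C a i = ∑ k, C k * (a i ^ 2) ^ (k : ℕ) := by
  simp [evenPolynomial, pow_mul]

theorem commute_evenPolynomial {r : ℕ} (C : Fin q → ℝ) (C' : Fin r → ℝ) (x : R) :
    Commute (evenPolynomial C x) (evenPolynomial C' x) :=
  Commute.sum_left _ _ _ fun _ _ => Commute.sum_right _ _ _ fun _ _ =>
    ((Commute.pow_pow_self x _ _).smul_left _).smul_right _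

theorem sum_smul_evenPolynomial {ι : Type*} [Fintype ι] (c : ι → ℝ) (C : ι → Fin q → ℝ) (x : R) :
    ∑ l, c l • evenPolynomial (C l) x = evenPolynomial (fun k => ∑ l, c l * C l k) x := by
  simp only [evenPolynomial, Finset.smul_sum, smul_smul, Finset.sum_smul]
  exact Finset.sum_comm

theorem evenPolynomial_cons (c : ℝ) (C : Fin q → ℝ) (x : R) :
    evenPolynomial (Fin.cons c C) x = c • 1 + evenPolynomial (Fin.cons 0 C) x := by
  simp [evenPolynomial, Fin.sum_univ_succ]

end EvenPolynomial

section SpectralDescription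

theorem isHermitian_evenPolynomial {q : ℕ} (C : Fin q → ℝ) (A : E n F) :
    (evenPolynomial C (A : Matrix (Fin n) (Fin n) F)).IsHermitian := by
  simp only [Matrix.IsHermitian, evenPolynomial, Matrix.conjTranspose_sum,
    Matrix.conjTranspose_smul, Matrix.conjTranspose_pow, conjTranspose_coe, star_trivial]

section

variable {A : E n F} {U : unitary (Matrix (Fin n) (Fin n) F)} {a : Fin n → ℝ}

theorem f_eq_sum (hA : A = unitaryDiagonal U a) (k : ℕ) : f k A = ∑ i, a i ^ k := by
  rw [f_eq_reTrace, hA, ← map_pow, reTrace_unitaryDiagonal]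
  rfl

theorem norm_sq_eq_sum (hA : A = unitaryDiagonal U a) : ‖A‖ ^ 2 = ∑ i, a i ^ 2 := by
  rw [← real_inner_self_eq_norm_sq, Submodule.coe_inner, hA, inner_unitaryDiagonal]
  simp only [sq]

theorem sum_eq_zero_of_eq_unitaryDiagonal (hA : A = unitaryDiagonal U a) : ∑ i, a i = 0 :=
  unitaryDiagonal_mem_E_iff.1 (hA ▸ A.2)

theorem sum_odd_pow_eq_zero_of_Phi_eq_zero (hPhi : Phi A = 0) (hA : A = unitaryDiagonal U a) {k : ℕ}
    (hk : Odd k) (hkn : k ≤ n) : ∑ i, a i ^ k = 0 := by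
  obtain ⟨_ | j, rfl⟩ := hk
  · simpa using sum_eq_zero_of_eq_unitaryDiagonal hA
  · rw [← f_eq_sum hA]
    exact congrFun hPhi ⟨j, by omega⟩

end

variable [FiniteDimensional ℝ F]

theorem projE_evenPolynomial (C : Fin ((n - 1) / 2 + 1) → ℝ) (A : E n F) :
    projE n F (evenPolynomial C (A : Matrix (Fin n) (Fin n) F)) =
      ∑ j : Fin ((n - 1) / 2), C j.succ • evenNormal j A := by
  simp [evenPolynomial, evenNormal, Fin.sum_univ_succ, projE_one, mul_add]

variable [NeZero n] {A : E n F} {U : unitary (Matrix (Fin n) (Fin n) F)} {a : Fin n → ℝ}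

theorem linearIndependent_evenNormal_iff :
    (LinearIndependent ℝ fun j : Fin ((n - 1) / 2) => evenNormal j A) ↔
      LinearIndependent ℝ fun j : Fin ((n - 1) / 2 + 1) =>
        (A : Matrix (Fin n) (Fin n) F) ^ (2 * (j : ℕ)) := by
  rw [Fintype.linearIndependent_iff, Fintype.linearIndependent_iff]
  refine ⟨fun h g hg => ?_, fun h g hg => ?_⟩
  · have hsucc : ∀ j, g (Fin.succ j) = 0 := h (fun j => g j.succ) <| by
      rw [← projE_evenPolynomial, evenPolynomial, hg, map_zero]
    have hzero : reTrace n F (g 0 • 1) = 0 := by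
      simpa [Fin.sum_univ_succ, hsucc] using congrArg (reTrace n F) hg
    rw [map_smul, ← map_one (realDiagonal n F), reTrace_realDiagonal] at hzero
    exact Fin.cases (by simpa [NeZero.ne] using hzero) hsucc
  · let P := evenPolynomial (Fin.cons 0 g : Fin ((n - 1) / 2 + 1) → ℝ)
      (A : Matrix (Fin n) (Fin n) F)
    have hproj : projE n F P = 0 := by
      simpa only [P, projE_evenPolynomial, Fin.cons_succ] using hg
    have hscalar : P - (reTrace n F P / n) • 1 = 0 := by
      rw [← coe_projE (isHermitian_evenPolynomial _ A), hproj, ZeroMemClass.coe_zero]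
    have hvanish : evenPolynomial (Fin.cons (-(reTrace n F P / n)) g : Fin ((n - 1) / 2 + 1) → ℝ)
        (A : Matrix (Fin n) (Fin n) F) = 0 := by
      rwa [evenPolynomial_cons, neg_smul, neg_add_eq_sub]
    exact fun j => h _ hvanish j.succ

theorem linearIndependent_evenNormal_iff_spectrum (hA : A = unitaryDiagonal U a) :
    (LinearIndependent ℝ fun j : Fin ((n - 1) / 2) => evenNormal j A) ↔
      LinearIndependent ℝ fun j : Fin ((n - 1) / 2 + 1) => a ^ (2 * (j : ℕ)) := by
  rw [linearIndependent_evenNormal_iff, hA,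
    ← LinearMap.linearIndependent_iff (unitaryDiagonal U).toLinearMap
      (LinearMap.ker_eq_bot.2 (unitaryDiagonal_injective U))]
  simp only [← map_pow]
  rfl

theorem mem_B_iff (ha : Antitone a) (hA : A = unitaryDiagonal U a) :
    A ∈ B n F ↔ ∑ i, a i ^ 2 = 1 ∧ a ∈ spectralCone n := by
  rw [mem_B_iff_linearIndependent, linearIndependent_evenNormal_iff_spectrum hA,
    ← norm_sq_eq_sum hA, pow_eq_one_iff_of_nonneg (norm_nonneg _) two_ne_zero]
  refine and_congr_right fun hnorm => ?_
  have hne : a ≠ 0 := by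
    rintro rfl
    have hsq := norm_sq_eq_sum hA
    simp [hnorm] at hsq
  constructor
  · rintro ⟨hPhi, hindep⟩
    have hrev := rev_eq_neg_of_sum_odd_pow_eq_zero ha fun k =>
      sum_odd_pow_eq_zero_of_Phi_eq_zero hPhi hA
    rwa [mem_spectralCone_iff ha hrev hne, ← linearIndependent_even_pow_iff hrev]
  · intro h
    refine ⟨funext fun j => ?_, ?_⟩
    · exact (f_eq_sum hA _).trans (sum_odd_pow_eq_zero h.1 ⟨j + 1, by ring⟩)
    · rwa [linearIndependent_even_pow_iff h.1, ← mem_spectralCone_iff ha h.1 hne]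

theorem exists_spectrum_of_mem_B (hA : A ∈ B n F) :
    ∃ U ∈ Subgroup.connectedComponentOfOne (unitary (Matrix (Fin n) (Fin n) F)),
      ∃ a ∈ spectralCone n, ∑ i, a i ^ 2 = 1 ∧ A = unitaryDiagonal U a := by
  obtain ⟨U, hU, a, ha, hAa⟩ := exists_eq_unitaryDiagonal A.2.1
  obtain ⟨hnorm, hcone⟩ := (mem_B_iff ha hAa).1 hA
  exact ⟨U, hU, a, hcone, hnorm, hAa⟩

theorem coe_projE_unitaryDiagonal (ha : a ∈ spectralCone n) :
    (projE n F (unitaryDiagonal U a) : Matrix (Fin n) (Fin n) F) = unitaryDiagonal U a :=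
  congrArg Subtype.val
    (projE_coe ⟨_, unitaryDiagonal_mem_E_iff.2 (sum_eq_zero_of_mem_spectralCone ha)⟩)

theorem projE_unitaryDiagonal_mem_B (ha : a ∈ spectralCone n) (hnorm : ∑ i, a i ^ 2 = 1) :
    projE n F (unitaryDiagonal U a) ∈ B n F :=
  (mem_B_iff ha.2.1 (coe_projE_unitaryDiagonal ha)).2 ⟨hnorm, ha⟩

end SpectralDescription

section Connected

theorem continuous_unitaryDiagonal : Continuous
    fun q : unitary (Matrix (Fin n) (Fin n) F) × (Fin n → ℝ) => unitaryDiagonal q.1 q.2 := by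
  have hunitary := continuous_subtype_val.comp
    (continuous_fst (X := unitary (Matrix (Fin n) (Fin n) F)) (Y := Fin n → ℝ))
  have hdiagonal := (realDiagonal n F).toLinearMap.continuous_of_finiteDimensional.comp
    (continuous_snd (X := unitary (Matrix (Fin n) (Fin n) F)))
  exact (hunitary.mul hdiagonal).mul hunitary.star

variable [FiniteDimensional ℝ F]

theorem B_eq_image [NeZero n] : B n F =
    (fun q : unitary (Matrix (Fin n) (Fin n) F) × (Fin n → ℝ) =>
      projE n F (unitaryDiagonal q.1 (unitSpectrum q.2))) ''
        (Subgroup.connectedComponentOfOne (unitary (Matrix (Fin n) (Fin n) F)) ×ˢ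
          spectralCone n) := by
  ext A
  constructor
  · intro hA
    obtain ⟨U, hU, a, ha, hnorm, hAa⟩ := exists_spectrum_of_mem_B hA
    refine ⟨(U, a), ⟨hU, ha⟩, ?_⟩
    simp only [unitSpectrum_eq_self hnorm]
    rw [← hAa, projE_coe]
  · rintro ⟨⟨U, a⟩, ⟨-, ha⟩, rfl⟩
    exact projE_unitaryDiagonal_mem_B (unitSpectrum_mem ha) (sum_unitSpectrum_sq ha)

theorem isConnected_connectedComponentOfOne (G : Type*) [TopologicalSpace G] [Group G]
    [IsTopologicalGroup G] : IsConnected (Subgroup.connectedComponentOfOne G : Set G) :=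
  isConnected_connectedComponent

theorem isConnected_B (hn : 2 ≤ n) : IsConnected (B n F) := by
  have : NeZero n := ⟨by omega⟩
  have hcone : IsConnected (spectralCone n) :=
    ⟨nonempty_spectralCone hn, convex_spectralCone.isPreconnected⟩
  have hcont : ContinuousOn (fun q : unitary (Matrix (Fin n) (Fin n) F) × (Fin n → ℝ) =>
      projE n F (unitaryDiagonal q.1 (unitSpectrum q.2))) (Set.univ ×ˢ spectralCone n) := by
    have hspectrum : ContinuousOn (fun q : unitary (Matrix (Fin n) (Fin n) F) × (Fin n → ℝ) =>
        (q.1, unitSpectrum q.2)) (Set.univ ×ˢ spectralCone n) :=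
      continuousOn_fst.prodMk
        (continuousOn_unitSpectrum.comp continuousOn_snd fun _ hq => hq.2)
    have hdiagonal := continuous_unitaryDiagonal.comp_continuousOn hspectrum
    exact (projE n F).continuous.comp_continuousOn hdiagonal
  rw [B_eq_image]
  exact ((isConnected_connectedComponentOfOne _).prod hcone).image _
    (hcont.mono (Set.prod_mono_left (Set.subset_univ _)))

end Connected

section Full

theorem isFull_B [FiniteDimensional ℝ F] (hn : 2 ≤ n) : IsFull (B n F) := by
  have : NeZero n := ⟨by omega⟩
  refine isFull_of_forall_inner_eq_zero fun X hX => ?_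
  obtain ⟨U, -, d, hd, hXd⟩ := exists_eq_unitaryDiagonal X.2.1
  obtain ⟨a, ha⟩ := nonempty_spectralCone hn
  have hinner := hX _ (projE_unitaryDiagonal_mem_B (U := U) (unitSpectrum_mem ha)
    (sum_unitSpectrum_sq ha))
  rw [Submodule.coe_inner, coe_projE_unitaryDiagonal (unitSpectrum_mem ha), hXd,
    inner_unitaryDiagonal] at hinner
  have hzero := eq_zero_of_sum_mul_eq_zero (unitSpectrum_mem ha) hd
    (sum_eq_zero_of_eq_unitaryDiagonal hXd) hinner
  exact Subtype.ext (by rw [hXd, hzero, map_zero, ZeroMemClass.coe_zero])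

end Full

section Austere

theorem unitaryDiagonal_mul (U V : unitary (Matrix (Fin n) (Fin n) F)) (a : Fin n → ℝ) :
    unitaryDiagonal (U * V) a = Unitary.conjStarAlgAut ℝ _ U (unitaryDiagonal V a) := by
  simp [unitaryDiagonal]

variable (F) in
/-- Permutation matrices as unitary matrices. -/
def permUnitary (σ : Equiv.Perm (Fin n)) : unitary (Matrix (Fin n) (Fin n) F) :=
  ⟨σ.permMatrix F, by
    simp [Unitary.mem_iff, star_eq_conjTranspose, ← Matrix.permMatrix_mul]⟩

theorem unitaryDiagonal_permUnitary (σ : Equiv.Perm (Fin n)) (a : Fin n → ℝ) :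
    unitaryDiagonal (permUnitary F σ) a = realDiagonal n F (a ∘ σ) := by
  ext i j
  simp [unitaryDiagonal_apply, permUnitary, realDiagonal_eq_diagonal, Equiv.Perm.permMatrix,
    PEquiv.toMatrix_toPEquiv_mul, PEquiv.mul_toMatrix_toPEquiv, Matrix.diagonal_apply,
    Equiv.Perm.inv_def]

theorem unitaryDiagonal_mul_permUnitary (U : unitary (Matrix (Fin n) (Fin n) F))
    (σ : Equiv.Perm (Fin n)) (a : Fin n → ℝ) :
    unitaryDiagonal (U * permUnitary F σ) a = unitaryDiagonal U (a ∘ σ) := by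
  rw [unitaryDiagonal_mul, unitaryDiagonal_permUnitary]
  rfl

theorem conj_mem_E (U : unitary (Matrix (Fin n) (Fin n) F)) {A : Matrix (Fin n) (Fin n) F}
    (hA : A ∈ E n F) : Unitary.conjStarAlgAut ℝ _ U A ∈ E n F := by
  obtain ⟨hherm, htrace⟩ := mem_E_iff.1 hA
  refine mem_E_iff.2 ⟨?_, (reTrace_unitary_conj U A).trans htrace⟩
  rw [Matrix.IsHermitian, ← star_eq_conjTranspose, ← map_star, star_eq_conjTranspose, hherm]

theorem norm_conj (U : unitary (Matrix (Fin n) (Fin n) F)) (A : Matrix (Fin n) (Fin n) F) :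
    ‖Unitary.conjStarAlgAut ℝ _ U A‖ = ‖A‖ := by
  have hsq : ‖Unitary.conjStarAlgAut ℝ _ U A‖ ^ 2 = ‖A‖ ^ 2 := by
    rw [← real_inner_self_eq_norm_sq, ← real_inner_self_eq_norm_sq, inner_eq_reTrace,
      inner_eq_reTrace, ← star_eq_conjTranspose, ← map_star, ← map_mul]
    exact reTrace_unitary_conj U _
  exact (pow_left_inj₀ (norm_nonneg _) (norm_nonneg _) two_ne_zero).1 hsq

variable [FiniteDimensional ℝ F]

/-- The isometry `A ↦ -U * A * Uᴴ` of the traceless Hermitian matrices. -/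
def negConj (U : unitary (Matrix (Fin n) (Fin n) F)) : E n F ≃ₗᵢ[ℝ] E n F :=
  LinearIsometry.toLinearIsometryEquiv
    { toFun := fun A => ⟨-Unitary.conjStarAlgAut ℝ _ U A, (E n F).neg_mem (conj_mem_E U A.2)⟩
      map_add' := fun A A' => Subtype.ext ((congrArg Neg.neg (map_add _ _ _)).trans (neg_add _ _))
      map_smul' := fun r A => Subtype.ext (by simp)
      norm_map' := fun A => (norm_neg _).trans (norm_conj U A) } rfl

theorem coe_negConj (U : unitary (Matrix (Fin n) (Fin n) F)) (A : E n F) :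
    (negConj U A : Matrix (Fin n) (Fin n) F) = -Unitary.conjStarAlgAut ℝ _ U A :=
  rfl

variable [NeZero n]

theorem negConj_mem_B (U : unitary (Matrix (Fin n) (Fin n) F)) {A : E n F} (hA : A ∈ B n F) :
    negConj U A ∈ B n F := by
  obtain ⟨V, -, a, ha, hnorm, hAa⟩ := exists_spectrum_of_mem_B hA
  have hspectrum : (negConj U A : Matrix (Fin n) (Fin n) F) =
      unitaryDiagonal (U * V * permUnitary F Fin.revPerm) a := by
    rw [coe_negConj, hAa, ← unitaryDiagonal_mul, unitaryDiagonal_mul_permUnitary, ← map_neg]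
    exact congrArg _ (funext fun i => by simp [ha.1])
  exact (mem_B_iff ha.2.1 hspectrum).2 ⟨hnorm, ha⟩

variable (n F) in
theorem isAustere_B : IsAustere (S n F) (B n F) := by
  refine (isRegularLevelSet_B n F).isAustere fun A hA => ?_
  obtain ⟨U, -, a, ha, -, hAa⟩ := exists_spectrum_of_mem_B hA
  let R := U * permUnitary F Fin.revPerm * U⁻¹
  have hconj : ∀ b : Fin n → ℝ, Unitary.conjStarAlgAut ℝ _ R (unitaryDiagonal U b) =
      unitaryDiagonal U (b ∘ Fin.revPerm) := fun b => by
    rw [← unitaryDiagonal_mul, inv_mul_cancel_right, unitaryDiagonal_mul_permUnitary]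
  have hsymm : ∀ b : Fin n → ℝ, (∀ i, b i.rev = b i) →
      Unitary.conjStarAlgAut ℝ _ R (unitaryDiagonal U b) = unitaryDiagonal U b := fun b hb => by
    rw [hconj]
    exact congrArg _ (funext hb)
  refine ⟨negConj R, fun Y => negConj_mem_B R, Subtype.ext ?_, fun v hv => ?_⟩
  · rw [coe_negConj, hAa, hconj, ← map_neg]
    exact congrArg _ (funext fun i => by simp [ha.1])
  · rw [normalSpace_B hA] at hv
    refine LinearMap.eqOn_span (f := (negConj R).toLinearEquiv.toLinearMap) (g := -LinearMap.id)
      ?_ hv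
    rintro _ ⟨j, rfl⟩
    change negConj R (evenNormal j A) = -evenNormal j A
    have hpow : (A : Matrix (Fin n) (Fin n) F) ^ (2 * (j : ℕ) + 2) =
      unitaryDiagonal U (a ^ (2 * (j : ℕ) + 2)) := by rw [hAa, map_pow]
    have heven : Even (2 * (j : ℕ) + 2) := ⟨j + 1, by ring⟩
    refine Subtype.ext ((coe_negConj R _).trans (congrArg Neg.neg ?_))
    rw [evenNormal, hpow, coe_projE (unitaryDiagonal_conjTranspose U _), map_sub,
      map_smul, map_one, hsymm _ fun i => by simp [ha.1, heven.neg_pow]]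

end Austere

section Dimension

variable (n F) in
/-- The entries above the diagonal of a traceless Hermitian matrix, and the real parts of the
diagonal entries of its sum with a multiple of the unit matrix. -/
def coordinates : E n F × ℝ →ₗ[ℝ] ((Σ j : Fin n, Fin j) → F) × (Fin n → ℝ) where
  toFun q := (fun s => (q.1 : Matrix (Fin n) (Fin n) F) (s.2.castLE s.1.2.le) s.1,
    fun i => inner ℝ (1 : F) ((q.1 : Matrix (Fin n) (Fin n) F) i i) + q.2)
  map_add' q q' := by
    ext
    · simp
    · simp only [Prod.fst_add, Prod.snd_add, Submodule.coe_add, Matrix.add_apply, inner_add_right,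
        Pi.add_apply]
      ring
  map_smul' r q := by
    ext
    · simp
    · simp [inner_smul_right, mul_add]

variable [NeZero n]

theorem coordinates_injective : Function.Injective (coordinates n F) := by
  rw [injective_iff_map_eq_zero]
  rintro ⟨A, t⟩ hzero
  have hupper : ∀ i j : Fin n, i < j → (A : Matrix (Fin n) (Fin n) F) i j = 0 := fun i j hij =>
    congrFun (congrArg Prod.fst hzero) ⟨j, ⟨i, hij⟩⟩
  have hdiag : ∀ i, inner ℝ (1 : F) ((A : Matrix (Fin n) (Fin n) F) i i) + t = 0 :=
    congrFun (congrArg Prod.snd hzero)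
  obtain rfl : t = 0 := by
    have hsum := Finset.sum_congr rfl fun i (_ : i ∈ Finset.univ) => hdiag i
    rw [Finset.sum_add_distrib, ← reTrace_apply, (mem_E_iff.1 A.2).2] at hsum
    simpa [NeZero.ne n] using hsum
  have hstar : ∀ i j, star ((A : Matrix (Fin n) (Fin n) F) j i) =
      (A : Matrix (Fin n) (Fin n) F) i j := fun i j => congrFun (congrFun (conjTranspose_coe A) i) j
  refine Prod.ext (Subtype.ext (Matrix.ext fun i j => ?_)) rfl
  change (A : Matrix (Fin n) (Fin n) F) i j = 0
  rcases lt_trichotomy i j with hij | rfl | hij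
  · exact hupper i j hij
  · rw [HermitianAlgebra.eq_re_smul_one _ (hstar i i), ← add_zero (inner ℝ 1 _), hdiag i, zero_smul]
  · rw [← hstar, hupper j i hij, star_zero]

variable [FiniteDimensional ℝ F]

theorem coordinates_surjective : Function.Surjective (coordinates n F) := by
  rintro ⟨u, d⟩
  let A : Matrix (Fin n) (Fin n) F := Matrix.of fun i j =>
    if h : i < j then u ⟨j, ⟨i, h⟩⟩ else if h : j < i then star (u ⟨i, ⟨j, h⟩⟩) else d i • 1
  have hA : A.IsHermitian := by
    ext i j
    rcases lt_trichotomy i j with hij | rfl | hij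
    · simp [A, hij, hij.not_gt]
    · simp [A]
    · simp [A, hij, hij.not_gt]
  refine ⟨(projE n F A, reTrace n F A / n), ?_⟩
  simp only [coordinates, LinearMap.coe_mk, AddHom.coe_mk, coe_projE hA]
  refine Prod.ext (funext fun ⟨j, i⟩ => ?_) (funext fun i => ?_)
  · have hij : Fin.castLE j.2.le i < j := i.2
    simp [A, hij, hij.ne]
  · simp [A, inner_sub_right, inner_smul_right, HermitianAlgebra.norm_one]

theorem finrank_E : Module.finrank ℝ (E n F) = N n F := by
  have hequiv := (LinearEquiv.ofBijective (coordinates n F)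
    ⟨coordinates_injective, coordinates_surjective⟩).finrank_eq
  have hpairs : Fintype.card (Σ j : Fin n, Fin j) = n * (n - 1) / 2 := by
    simp only [Fintype.card_sigma, Fintype.card_fin]
    rw [Fin.sum_univ_eq_sum_range (fun j => j), Finset.sum_range_id]
  rw [Module.finrank_prod, Module.finrank_prod, Module.finrank_self,
    Module.finrank_fintype_fun_eq_card, Module.finrank_pi_fintype, Finset.sum_const, smul_eq_mul,
    Finset.card_univ, hpairs, Fintype.card_fin] at hequiv
  rw [N]
  omega

theorem codim_add (hn : 2 ≤ n) : N n F - (n - 1) / 2 - 1 +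
    Module.finrank ℝ (ℝ × (Fin ((n - 1) / 2) → ℝ)) = Module.finrank ℝ (E n F) := by
  rw [finrank_E, N, Module.finrank_prod, Module.finrank_self, Module.finrank_fin_fun]
  generalize n * (n - 1) / 2 * Module.finrank ℝ F = k
  omega

end Dimension

section FlatNormalBundle

theorem reTrace_mul_eq_zero_of_idempotent {Q Q' D : Matrix (Fin n) (Fin n) F} (hQ : Q * Q = Q)
    (hQ' : Q' = Q' * Q + Q * Q') (hD : Commute Q D) : reTrace n F (Q' * D) = 0 := by
  have hcorner : Q * Q' * Q = 0 := by
    have hmul := congrArg (Q * ·) hQ'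
    simp only [mul_add, ← mul_assoc, hQ] at hmul
    exact right_eq_add.1 hmul
  have hleft : reTrace n F (Q' * Q * D) = 0 := by
    calc reTrace n F (Q' * Q * D) = reTrace n F (Q' * Q * D * Q) := by
          rw [mul_assoc _ D, ← hD.eq, ← mul_assoc, mul_assoc Q' Q Q, hQ]
      _ = 0 := by rw [reTrace_mul_comm, ← mul_assoc, ← mul_assoc, hcorner, zero_mul, map_zero]
  have hright : reTrace n F (Q * Q' * D) = 0 := by
    rw [mul_assoc, reTrace_mul_comm, mul_assoc, ← hD.eq, ← mul_assoc, hleft]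
  rw [hQ', add_mul, map_add, hleft, hright, add_zero]

theorem deriv_eq_of_idempotent {R : Type*} [NormedRing R] [NormedAlgebra ℝ R] {Q : ℝ → R} {Q' : R}
    {t : ℝ} (h : HasDerivAt Q Q' t) (hQ : ∀ᶠ s in 𝓝 t, Q s * Q s = Q s) :
    Q' = Q' * Q t + Q t * Q' :=
  h.unique ((h.mul h).congr_of_eventuallyEq (hQ.mono fun _ hs => hs.symm))

theorem contDiffOn_evenPolynomial {q : ℕ} {O : Set (E n F)} {C : Fin q → E n F → ℝ}
    (hC : ∀ k, ContDiffOn ℝ ∞ (C k) O) : ContDiffOn ℝ ∞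
      (fun A : E n F => evenPolynomial (fun k => C k A) (A : Matrix (Fin n) (Fin n) F)) O :=
  ContDiffOn.sum fun k _ => (hC k).smul (contDiff_coe_pow _).contDiffOn

/-- Half the even power traces: on `B n F` these are the power sums of the distinct squares of the
eigenvalues. -/
def halfTraces (A : E n F) : Fin ((n - 1) / 2 + 1) → ℝ := fun k => f (2 * ((k : ℕ) + 1)) A / 2

theorem halfTraces_eq_powerSums [NeZero n] {A : E n F} {U : unitary (Matrix (Fin n) (Fin n) F)}
    {a : Fin n → ℝ} (ha : a ∈ spectralCone n) (hAa : A = unitaryDiagonal U a) :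
    halfTraces A = powerSums fun l => a (halfIndex n l) ^ 2 := by
  ext k
  rw [powerSums_halfIndex ha.1, halfTraces, f_eq_sum hAa]

variable [FiniteDimensional ℝ F]

theorem inner_hasDerivAt_projE_eq_zero {ι : Type*} [Fintype ι] (c : ι → ℝ)
    {Q : ι → ℝ → Matrix (Fin n) (Fin n) F} {t : ℝ} (hQ : ∀ l, DifferentiableAt ℝ (Q l) t)
    (hidem : ∀ l, ∀ᶠ s in 𝓝 t, Q l s * Q l s = Q l s) {D v : E n F}
    (hD : HasDerivAt (fun s => projE n F (∑ l, c l • Q l s)) D t)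
    (hv : ∀ l, Commute (Q l t) v) : inner ℝ v D = 0 := by
  have hsum : HasDerivAt (fun s => ∑ l, c l • Q l s) (∑ l, c l • deriv (Q l) t) t :=
    HasDerivAt.fun_sum fun l _ => (hQ l).hasDerivAt.const_smul (c l)
  rw [hD.unique ((projE n F).hasFDerivAt.comp_hasDerivAt t hsum), real_inner_comm, inner_projE,
    Finset.sum_mul, map_sum]
  refine Finset.sum_eq_zero fun l _ => ?_
  rw [smul_mul_assoc, map_smul, reTrace_mul_eq_zero_of_idempotent (hidem l).self_of_nhds
    (deriv_eq_of_idempotent (hQ l).hasDerivAt (hidem l)) (hv l), smul_zero]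

theorem normalDerivative_sum_idempotent_eq_zero {ι : Type*} [Fintype ι] (c : ι → ℝ)
    {Q : ι → E n F → Matrix (Fin n) (Fin n) F} {M N : Set (E n F)} {A : E n F}
    (hQ : ∀ l, DifferentiableAt ℝ (Q l) A) (hidem : ∀ l, ∀ᶠ X in 𝓝[M] A, Q l X * Q l X = Q l X)
    (hcomm : ∀ l, ∀ v ∈ normalSpace N M A, Commute (Q l A) v) :
    normalDerivative N M (fun X => projE n F (∑ l, c l • Q l X)) A = 0 := by
  refine normalDerivative_eq_zero (DifferentiableAt.differentiableWithinAt ?_) ?_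
  · exact (projE n F).differentiableAt.comp A
      (DifferentiableAt.fun_sum fun l _ => (hQ l).const_smul (c l))
  · rintro X γ hγ D hD v hv
    obtain rfl := hγ.zero
    exact inner_hasDerivAt_projE_eq_zero c
      (fun l => (hQ l).comp (0 : ℝ) hγ.hasDerivAt.differentiableAt)
      (fun l => hγ.tendsto.eventually (hidem l)) hD fun l => hcomm l v hv

theorem mem_normalSpace_B_iff {A v : E n F} (hA : A ∈ B n F) :
    v ∈ normalSpace (S n F) (B n F) A ↔ ∃ C : Fin ((n - 1) / 2 + 1) → ℝ,
      v = projE n F (evenPolynomial C (A : Matrix (Fin n) (Fin n) F)) := by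
  rw [normalSpace_B hA, Submodule.mem_span_range_iff_exists_fun]
  simp only [projE_evenPolynomial]
  constructor
  · rintro ⟨C, rfl⟩
    exact ⟨Fin.cons 0 C, rfl⟩
  · rintro ⟨C, rfl⟩
    exact ⟨fun j => C j.succ, rfl⟩

theorem contDiff_halfTraces :
    ContDiff ℝ ∞ (halfTraces : E n F → Fin ((n - 1) / 2 + 1) → ℝ) :=
  contDiff_pi.2 fun _ => (contDiff_f _).div_const 2

variable [NeZero n] {A : E n F}

theorem commute_evenPolynomial_of_mem_normalSpace_B (hA : A ∈ B n F) {v : E n F}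
    (hv : v ∈ normalSpace (S n F) (B n F) A) {q : ℕ} (C : Fin q → ℝ) :
    Commute (evenPolynomial C (A : Matrix (Fin n) (Fin n) F)) v := by
  obtain ⟨C', rfl⟩ := (mem_normalSpace_B_iff hA).1 hv
  rw [coe_projE (isHermitian_evenPolynomial C' A)]
  exact (commute_evenPolynomial C C' _).sub_right ((Commute.one_right _).smul_right _)

theorem exists_spectrum_sq_eq (hA : A ∈ B n F) {m : Fin ((n - 1) / 2 + 1) → ℝ}
    (hm : powerSums m = halfTraces A) :
    ∃ (U : unitary (Matrix (Fin n) (Fin n) F)) (a : Fin n → ℝ),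
      A = unitaryDiagonal U a ∧ ∀ i, ∃ j, a i ^ 2 = m j := by
  obtain ⟨U, -, a, ha, -, hAa⟩ := exists_spectrum_of_mem_B hA
  refine ⟨U, a, hAa, fun i => ?_⟩
  rw [halfTraces_eq_powerSums ha hAa] at hm
  obtain ⟨j, hj⟩ := exists_eq_of_powerSums_eq hm.symm (foldIndex i)
  refine ⟨j, hj ▸ ?_⟩
  rcases halfIndex_foldIndex i with hi | hi <;> simp [hi, ha.1]

theorem evenPolynomial_mul_self (hA : A ∈ B n F) {m C : Fin ((n - 1) / 2 + 1) → ℝ}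
    (hm : powerSums m = halfTraces A) {l : Fin ((n - 1) / 2 + 1)}
    (hC : ∀ j, ∑ k, C k * m j ^ (k : ℕ) = if l = j then 1 else 0) :
    evenPolynomial C (A : Matrix (Fin n) (Fin n) F) * evenPolynomial C (A : Matrix _ _ F) =
      evenPolynomial C (A : Matrix _ _ F) := by
  obtain ⟨U, a, hAa, hsq⟩ := exists_spectrum_sq_eq hA hm
  rw [hAa, ← map_evenPolynomial, ← map_mul]
  congr 1
  ext i
  obtain ⟨j, hj⟩ := hsq i
  simp [evenPolynomial_apply, hj, hC]

theorem sum_smul_lagrange_eq (hA : A ∈ B n F) {m g : Fin ((n - 1) / 2 + 1) → ℝ}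
    {C : Fin ((n - 1) / 2 + 1) → Fin ((n - 1) / 2 + 1) → ℝ} (hm : powerSums m = halfTraces A)
    (hC : ∀ l j, ∑ k, C l k * m j ^ (k : ℕ) = if l = j then 1 else 0) :
    ∑ l, (∑ k, g k * m l ^ (k : ℕ)) • evenPolynomial (C l) (A : Matrix (Fin n) (Fin n) F) =
      evenPolynomial g (A : Matrix (Fin n) (Fin n) F) := by
  obtain ⟨U, a, hAa, hsq⟩ := exists_spectrum_sq_eq hA hm
  simp only [hAa, ← map_evenPolynomial, ← map_smul]
  rw [← map_sum]
  congr 1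
  ext i
  obtain ⟨j, hj⟩ := hsq i
  simp [evenPolynomial_apply, hj, hC]

/- A normal vector at `A` is an even polynomial in `A`, hence a linear combination of the spectral
projections of `A ^ 2`; the parallel extension keeps the coefficients and lets the projections
vary. -/
variable (n F) in
theorem hasFlatNormalBundle_B : HasFlatNormalBundle (S n F) (B n F) := by
  intro A hA v hv
  obtain ⟨U, -, a, ha, hnorm, hAa⟩ := exists_spectrum_of_mem_B hA
  have hne : a ≠ 0 := by
    rintro rfl
    simp at hnorm
  obtain ⟨T, m, C, hT, hAT, hC, hlagrange⟩ :=
    exists_smooth_lagrange ((mem_spectralCone_iff ha.2.1 ha.1 hne).1 ha)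
  rw [← halfTraces_eq_powerSums ha hAa] at hAT
  obtain ⟨g, rfl⟩ := (mem_normalSpace_B_iff hA).1 hv
  let O : Set (E n F) := halfTraces ⁻¹' T
  have hO : IsOpen O := hT.preimage contDiff_halfTraces.continuous
  let Q : Fin ((n - 1) / 2 + 1) → E n F → Matrix (Fin n) (Fin n) F := fun l X =>
    evenPolynomial (fun k => C l k (halfTraces X)) X
  have hQ : ∀ l, ContDiffOn ℝ ∞ (Q l) O := fun l => contDiffOn_evenPolynomial fun k =>
    (hC l k).comp contDiff_halfTraces.contDiffOn fun _ hX => hX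
  let c : Fin ((n - 1) / 2 + 1) → ℝ := fun l => ∑ k, g k * m (halfTraces A) l ^ (k : ℕ)
  refine ⟨O, fun X => projE n F (∑ l, c l • Q l X), hO, hAT, ⟨?_, fun X hX => ?_⟩, ?_,
    fun X hX => normalDerivative_sum_idempotent_eq_zero c (fun l => ?_) (fun l => ?_) ?_⟩
  · exact ((projE n F).contDiff.comp_contDiffOn
      (ContDiffOn.sum fun l _ => (hQ l).const_smul (c l))).mono Set.inter_subset_right
  · rw [mem_normalSpace_B_iff hX.1, sum_smul_evenPolynomial]
    exact ⟨_, rfl⟩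
  · exact congrArg _ (sum_smul_lagrange_eq hA (hlagrange _ hAT).1 (hlagrange _ hAT).2)
  · exact ((hQ l).contDiffAt (hO.mem_nhds hX.2)).differentiableAt (by simp)
  · filter_upwards [self_mem_nhdsWithin, mem_nhdsWithin_of_mem_nhds (hO.mem_nhds hX.2)]
      with Y hYB hYO
    exact evenPolynomial_mul_self hYB (hlagrange _ hYO).1 ((hlagrange _ hYO).2 l)
  · exact fun l v hv => commute_evenPolynomial_of_mem_normalSpace_B hX.1 hv _

end FlatNormalBundle

end HermitianSphere

open EuclideanSubmanifold HermitianSphere in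
theorem mainTheorem1_general {n : ℕ} (F : Type*) [NormedRing F] [StarRing F]
    [InnerProductSpace ℝ F] [StarModule ℝ F] [HermitianAlgebra F] [FiniteDimensional ℝ F]
    (hn : 2 ≤ n) :
    B n F ⊆ S n F ∧
      IsSubmanifold (B n F) (N n F - (n - 1) / 2 - 1) ∧
      IsOrientable (B n F) (N n F - (n - 1) / 2 - 1) ∧
      IsConnected (B n F) ∧
      IsFull (B n F) ∧
      IsAustere (S n F) (B n F) ∧
      HasFlatNormalBundle (S n F) (B n F) :=
  have : NeZero n := ⟨by omega⟩
  have hlevel := isRegularLevelSet_B n F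
  ⟨fun _ hA => hA.1, hlevel.isSubmanifold (codim_add hn), hlevel.isOrientable (codim_add hn),
    isConnected_B hn, isFull_B hn, isAustere_B n F, hasFlatNormalBundle_B n F⟩

end

open EuclideanSubmanifold HermitianSphere in
theorem mainTheorem1 (n : ℕ) (hn : 2 ≤ n) :
    (B n ℝ ⊆ S n ℝ ∧
      IsSubmanifold (B n ℝ) (N n ℝ - (n - 1) / 2 - 1) ∧
      IsOrientable (B n ℝ) (N n ℝ - (n - 1) / 2 - 1) ∧
      IsConnected (B n ℝ) ∧
      IsFull (B n ℝ) ∧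
      IsAustere (S n ℝ) (B n ℝ) ∧
      HasFlatNormalBundle (S n ℝ) (B n ℝ)) ∧
    (B n ℂ ⊆ S n ℂ ∧
      IsSubmanifold (B n ℂ) (N n ℂ - (n - 1) / 2 - 1) ∧
      IsOrientable (B n ℂ) (N n ℂ - (n - 1) / 2 - 1) ∧
      IsConnected (B n ℂ) ∧
      IsFull (B n ℂ) ∧
      IsAustere (S n ℂ) (B n ℂ) ∧
      HasFlatNormalBundle (S n ℂ) (B n ℂ)) ∧
    (B n ℍ[ℝ] ⊆ S n ℍ[ℝ] ∧
      IsSubmanifold (B n ℍ[ℝ]) (N n ℍ[ℝ] - (n - 1) / 2 - 1) ∧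
      IsOrientable (B n ℍ[ℝ]) (N n ℍ[ℝ] - (n - 1) / 2 - 1) ∧
      IsConnected (B n ℍ[ℝ]) ∧
      IsFull (B n ℍ[ℝ]) ∧
      IsAustere (S n ℍ[ℝ]) (B n ℍ[ℝ]) ∧
      HasFlatNormalBundle (S n ℍ[ℝ]) (B n ℍ[ℝ])) :=
  ⟨mainTheorem1_general ℝ hn, mainTheorem1_general ℂ hn, mainTheorem1_general ℍ[ℝ] hn⟩
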